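/- Let $\mathfrak g$ be a finite-dimensional complex semisimple Lie algebra (for instance the complexification of a simple real Lie algebra of compact type), $\mathfrak h$ a Cartan subalgebra, $l=\dim\mathfrak h$ the rank, $R$ the root system, and fix a base of $R$, hence the positive roots $\alpha>0$; let $H_\alpha$ be the coroot of $\alpha$. Fix a basis $H_1,\dots,H_l$ of $\mathfrak h$ and root vectors $\tau_\alpha$ ($\alpha\in R$) with $[\tau_\alpha,\tau_{-\alpha}]=-H_\alpha$; write $H_\alpha=\sum_i H_\alpha^iH_i$ and $[\tau_\alpha,\tau_\beta]=N_{\alpha\beta}\tau_{\alpha+\beta}$ for $\alpha+\beta\in R$, and $N_{\alpha\beta}=0$ if $\alpha+\beta\notin R$. Let $\chi\in\mathfrak g^*$ vanish on all root vectors and lie in the interior of the dominant Weyl chamber: $\langle\chi,H_\alpha\rangle$ is real and positive for every simple root $\alpha$. Let $V$ be any complex representation of $\mathfrak g$, $x\mapsto\tilde{\mathcal L}_x$, and put $\mathcal L_x=\tilde{\mathcal L}_x-\langle\chi,x\rangle$. On $\mathcal C=\bigwedge\mathfrak g^*$ let $b_i,b_\alpha$ be the contractions with $H_i,\tau_\alpha$,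 let $c^i$ be exterior multiplication by the form dual to $H_i$, and $c^\alpha$ exterior multiplication by the form dual to $\tau_{-\alpha}$ (dual basis of $\{H_i,\tau_\alpha\}$). Put $$L_\alpha=-\sum_{\beta\in R}N_{\alpha\beta}\,c^{-\beta}b_{\alpha+\beta}+\sum_i H^i_\alpha\,c^\alpha b_i+\sum_i\alpha(H_i)\,c^ib_\alpha,\qquad L_i=-\sum_{\beta>0}\beta(H_i)\bigl(c^{-\beta}b_\beta+b_{-\beta}c^\beta\bigr),$$ $$d=\tfrac12\sum_{\alpha>0}c^{-\alpha}L_\alpha+\tfrac12\sum_{\alpha>0}L_{-\alpha}c^\alpha+\tfrac12\sum_ic^iL_i,$$ $$\mathrm{gh}=\sum_{\alpha>0}c^{-\alpha}b_\alpha-\sum_{\alpha>0}b_{-\alpha}c^\alpha+\tfrac12\sum_i(c^ib_i-b_ic^i),$$ and on $\mathcal C\otimes V$ put $$D=\sum_{\alpha\in R}c^{-\alpha}\otimes\mathcal L_{\tau_\alpha}+\sum_ic^i\otimes\mathcal L_{H_i}+d\otimes1 .$$ Let $\mathcal A=\ker D^2$, let $\mathcal A^r$ be the subspace of $\mathcal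 A$ on which $\mathrm{gh}\otimes1$ acts as $r$, and define the absolute anomalous cohomology $H^r=Z^r/B^r$, where $Z^r=\ker D|_{\mathcal A^r}$ and $B^r=D(\mathcal A^{r-1})$. Then $H^r=0$ for every real $r>l/2$. -/

import Mathlib

open scoped TensorProduct

namespace AnomalousBRST

noncomputable section

open LieAlgebra LieAlgebra.IsKilling Module

section LieData

variable {𝔤 : Type*} [LieRing 𝔤] [LieAlgebra ℂ 𝔤] [FiniteDimensional ℂ 𝔤] [IsKilling ℂ 𝔤]

/-- The opposite root `-α`. -/
def negRoot {H : LieSubalgebra ℂ 𝔤} [H.IsCartanSubalgebra] (α : H.root) : H.root :=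
  ⟨-α.1, by
    have h := α.2
    simp only [Finset.mem_filter, Finset.mem_univ, true_and] at h ⊢
    exact h.neg⟩

/-- The finite set of roots that are positive with respect to a base. -/
def posRoots {H : LieSubalgebra ℂ 𝔤} [H.IsCartanSubalgebra] (Δ : (rootSystem H).Base) :
    Finset H.root :=
  haveI : DecidablePred Δ.IsPos := Classical.decPred _
  Finset.univ.filter Δ.IsPos

/-- A basis of `𝔤` adapted to the root decomposition: vectors `H_1, …, H_l` of the Cartan
subalgebra (`l` the rank) and root vectors `τ_α`, one for each root, with
`[τ_α, τ_{-α}] = -H_α` where `H_α` is the coroot (so `α(H_α) = 2`).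
Chevalley bases, in this sign convention, are the special case where moreover
`[τ_α, τ_β] = N_{αβ} τ_{α+β}` with real `N_{αβ} = N_{-α,-β}`. -/
structure RootBasis (H : LieSubalgebra ℂ 𝔤) [H.IsCartanSubalgebra] where
  toBasis : Basis (Fin (finrank ℂ H) ⊕ H.root) ℂ 𝔤
  cartan_mem : ∀ i, toBasis (Sum.inl i) ∈ H
  root_mem : ∀ α : H.root, toBasis (Sum.inr α) ∈ rootSpace H α.1
  lie_neg : ∀ α : H.root,
    ⁅toBasis (Sum.inr α), toBasis (Sum.inr (negRoot α))⁆ = -((coroot α.1 : H) : 𝔤)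

/-- `χ ∈ 𝔤^*` lies in `𝔥^*` (it vanishes on all root spaces), is real on the coroots, and belongs
to the interior of the Weyl chamber of the base `Δ`: `⟨χ, H_α⟩ > 0` for every simple root `α`. -/
def IsRegularDominant {H : LieSubalgebra ℂ 𝔤} [H.IsCartanSubalgebra] (Δ : (rootSystem H).Base)
    (χ : Dual ℂ 𝔤) : Prop :=
  (∀ α : H.root, ∀ x ∈ rootSpace H α.1, χ x = 0) ∧
    ∀ α ∈ Δ.support, ∃ t : ℝ, 0 < t ∧ χ ((coroot α.1 : H) : 𝔤) = (t : ℂ)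

end LieData

/-- The quotient `Z / B` (more precisely `Z / (Z ∩ B)`) of two subspaces of a vector space. -/
abbrev Subquotient {M : Type*} [AddCommGroup M] [Module ℂ M] (Z B : Submodule ℂ M) : Type _ :=
  Z ⧸ B.submoduleOf Z

/-- The ghost module `𝒞 = ⋀ 𝔤^*`. -/
abbrev Ghost (𝔤 : Type*) [LieRing 𝔤] [LieAlgebra ℂ 𝔤] : Type _ :=
  ExteriorAlgebra ℂ (Dual ℂ 𝔤)

/-- Multiplication by the one-form `θ` on `⋀ 𝔤^*`. -/
def wedge {𝔤 : Type*} [LieRing 𝔤] [LieAlgebra ℂ 𝔤] (θ : Dual ℂ 𝔤) : End ℂ (Ghost 𝔤) :=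
  LinearMap.mulLeft ℂ (ExteriorAlgebra.ι ℂ θ)

/-- Substitution (contraction) of the vector `x` on `⋀ 𝔤^*`: the antiderivation with
`θ ↦ θ x` on one-forms. -/
def subst {𝔤 : Type*} [LieRing 𝔤] [LieAlgebra ℂ 𝔤] (x : 𝔤) : End ℂ (Ghost 𝔤) :=
  CliffordAlgebra.contractLeft (Dual.eval ℂ 𝔤 x)

namespace RootBasis

variable {𝔤 : Type*} [LieRing 𝔤] [LieAlgebra ℂ 𝔤] [FiniteDimensional ℂ 𝔤] [IsKilling ℂ 𝔤]
  {H : LieSubalgebra ℂ 𝔤} [H.IsCartanSubalgebra] (T : RootBasis H)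

/-- The basis vector `H_i` of the Cartan subalgebra. -/
def cartan (i : Fin (finrank ℂ H)) : 𝔤 := T.toBasis (Sum.inl i)

/-- The root vector `τ_α`. -/
def rootVec (α : H.root) : 𝔤 := T.toBasis (Sum.inr α)

/-- The number `α(H_i)`. -/
def rootVal (α : H.root) (i : Fin (finrank ℂ H)) : ℂ := α.1 ⟨T.cartan i, T.cartan_mem i⟩

/-- The coordinate `H_α^i` of the coroot `H_α` in the basis `H_1, …, H_l`. -/
def corootCoord (α : H.root) (i : Fin (finrank ℂ H)) : ℂ :=
  T.toBasis.coord (Sum.inl i) ((coroot α.1 : H) : 𝔤)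

/-- The coefficient of `τ_γ` in `[τ_α, τ_β]`. It is `N_{αβ}` if `γ = α + β` and `0` otherwise. -/
def structConst (α β γ : H.root) : ℂ :=
  T.toBasis.coord (Sum.inr γ) ⁅T.rootVec α, T.rootVec β⁆

/-- The ghost `c^i`: multiplication by the form `θ^i` dual to `H_i`. -/
def cCartan (i : Fin (finrank ℂ H)) : End ℂ (Ghost 𝔤) := wedge (T.toBasis.coord (Sum.inl i))

/-- The anti-ghost `b_i`: substitution of `H_i`. -/
def bCartan (i : Fin (finrank ℂ H)) : End ℂ (Ghost 𝔤) := subst (T.cartan i)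

/-- The ghost `c^α`: multiplication by the form dual to `τ_{-α}`
(so `{c^α, b_β} = δ_{α,-β}`). -/
def c (α : H.root) : End ℂ (Ghost 𝔤) := wedge (T.toBasis.coord (Sum.inr (negRoot α)))

/-- The anti-ghost `b_α`: substitution of `τ_α`. -/
def b (α : H.root) : End ℂ (Ghost 𝔤) := subst (T.rootVec α)

/-- The ghost part `L_α` of the root vectors (the coadjoint action of `τ_α` on `⋀ 𝔤^*`, not
affected by normal ordering):
`L_α = - ∑_β N_{αβ} c^{-β} b_{α+β} + ∑_i H_α^i c^α b_i + ∑_i α(H_i) c^i b_α`. -/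
def ghostRoot (α : H.root) : End ℂ (Ghost 𝔤) :=
  -(∑ β : H.root, ∑ γ : H.root, T.structConst α β γ • (T.c (negRoot β) * T.b γ))
    + ∑ i, T.corootCoord α i • (T.c α * T.bCartan i)
    + ∑ i, T.rootVal α i • (T.cCartan i * T.b α)

/-- The normally ordered ghost part of the Cartan elements:
`L_i = - ∑_{β>0} β(H_i) c^{-β} b_β - ∑_{β>0} β(H_i) b_{-β} c^β`. -/
def ghostCartan (Δ : (rootSystem H).Base) (i : Fin (finrank ℂ H)) : End ℂ (Ghost 𝔤) :=
  -(∑ β ∈ posRoots Δ, T.rootVal β i • (T.c (negRoot β) * T.b β))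
    - ∑ β ∈ posRoots Δ, T.rootVal β i • (T.b (negRoot β) * T.c β)

/-- The anomalous (normally ordered) ghost differential
`d = ½ ∑_{α>0} c^{-α} L_α + ½ ∑_{α>0} L_{-α} c^α + ½ ∑_i c^i L_i`. -/
def ghostDiff (Δ : (rootSystem H).Base) : End ℂ (Ghost 𝔤) :=
  (1 / 2 : ℂ) • (∑ α ∈ posRoots Δ, T.c (negRoot α) * T.ghostRoot α)
    + (1 / 2 : ℂ) • (∑ α ∈ posRoots Δ, T.ghostRoot (negRoot α) * T.c α)
    + (1 / 2 : ℂ) • (∑ i, T.cCartan i * T.ghostCartan Δ i)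

/-- The ghost number operator
`∑_{α>0} c^{-α} b_α - ∑_{α>0} b_{-α} c^α + ½ ∑_i (c^i b_i - b_i c^i)`. -/
def ghostNumber (Δ : (rootSystem H).Base) : End ℂ (Ghost 𝔤) :=
  (∑ α ∈ posRoots Δ, T.c (negRoot α) * T.b α)
    - (∑ α ∈ posRoots Δ, T.b (negRoot α) * T.c α)
    + (1 / 2 : ℂ) • ∑ i, (T.cCartan i * T.bCartan i - T.bCartan i * T.cCartan i)

variable (Δ : (rootSystem H).Base) (χ : Dual ℂ 𝔤)
  (V : Type*) [AddCommGroup V] [Module ℂ V] [LieRingModule 𝔤 V] [LieModule ℂ 𝔤 V]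

/-- The constraint operator on `V`: the action of `x` shifted by `-⟨χ, x⟩`. -/
def constraint (x : 𝔤) : End ℂ V := LieModule.toEnd ℂ 𝔤 V x - χ x • (1 : End ℂ V)

/-- The differential
`D = ∑_α c^{-α} ⊗ ℒ_α + ∑_i c^i ⊗ ℒ_i + d ⊗ 1` on the total space `𝒞 ⊗ V`. -/
def totalDiff : End ℂ (Ghost 𝔤 ⊗[ℂ] V) :=
  (∑ α : H.root, TensorProduct.map (T.c (negRoot α)) (constraint χ V (T.rootVec α)))
    + (∑ i, TensorProduct.map (T.cCartan i) (constraint χ V (T.cartan i)))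
    + TensorProduct.map (T.ghostDiff Δ) LinearMap.id

/-- The subspace `𝒞^r(V)` of total ghost number `r`. -/
def ghostDegree (r : ℝ) : Submodule ℂ (Ghost 𝔤 ⊗[ℂ] V) :=
  End.eigenspace (TensorProduct.map (T.ghostNumber Δ) (LinearMap.id : V →ₗ[ℂ] V)) (r : ℂ)

/-- The anomalous cochains `𝒜 = ker D²`. -/
def anomalous : Submodule ℂ (Ghost 𝔤 ⊗[ℂ] V) :=
  LinearMap.ker (T.totalDiff Δ χ V * T.totalDiff Δ χ V)

/-- The anomalous cochains `𝒜^r` of ghost number `r`. -/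
def cochains (r : ℝ) : Submodule ℂ (Ghost 𝔤 ⊗[ℂ] V) :=
  T.anomalous Δ χ V ⊓ T.ghostDegree Δ V r

/-- The cocycles `Z^r`, the kernel of `D` on `𝒜^r`. -/
def cocycles (r : ℝ) : Submodule ℂ (Ghost 𝔤 ⊗[ℂ] V) :=
  T.cochains Δ χ V r ⊓ LinearMap.ker (T.totalDiff Δ χ V)

/-- The coboundaries `B^r`, the image of `𝒜^{r-1}` under `D`. -/
def coboundaries (r : ℝ) : Submodule ℂ (Ghost 𝔤 ⊗[ℂ] V) :=
  (T.cochains Δ χ V (r - 1)).map (T.totalDiff Δ χ V)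

/-- The absolute anomalous cohomology space `H^r = Z^r / B^r`. -/
abbrev cohomology (r : ℝ) : Type _ :=
  Subquotient (T.cocycles Δ χ V r) (T.coboundaries Δ χ V r)

end RootBasis

end

end AnomalousBRST

namespace AnomalousBRST

noncomputable section

open LieAlgebra LieAlgebra.IsKilling Module

/-! Let λ = χ + 2ρ, with 2ρ the sum of the positive roots extended by zero to 𝔤. Undoing the normal
ordering (`ghostDiff_eq`) and collecting the shifts by χ (`totalDiff_eq`) shows that D is the
ordinary Chevalley–Eilenberg differential with coefficients in V minus exterior multiplication by λ.
The former squares to zero, so D² is exterior multiplication by -dλ (`totalDiff_mul_self`).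

By the bracket relations dλ = ∑_{α>0} λ(H_α) θ^α ∧ θ^{-α} (`wd_eq_raising`), and every λ(H_α) is
nonzero because χ is positive on simple coroots and 2ρ equals 2 there. Hence dλ is symplectic on the
span of the root vectors and generates a Lefschetz sl₂ whose weight operator is gh + l/2 - K, where
K counts the Cartan ghosts and has eigenvalues among 0, …, l. In ghost number r > l/2 all weights
are positive, so dλ maps ghost number r - 2 onto ghost number r (`exists_raising_eq`,
`exists_wd_eq`). Nilpotency of the raising operator replaces finite dimensionality, so V is
arbitrary.

Given a cocycle u of degree r, write u = dλ ∧ w and take v = -Dw. Then Dv = -D²w = u, and D²v = Du =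
0, so v is an anomalous cochain and u is a coboundary. -/

/-- Exterior multiplications `w θ` and substitutions `s x` in an algebra `A`, subject to the
canonical anticommutation relations of the Clifford algebra of `𝔤^* ⊕ 𝔤`. -/
structure CliffordPair (𝔤 A : Type*) [LieRing 𝔤] [LieAlgebra ℂ 𝔤] [Ring A] [Algebra ℂ A] where
  w : Dual ℂ 𝔤 →ₗ[ℂ] A
  s : 𝔤 →ₗ[ℂ] A
  w_mul_self : ∀ θ, w θ * w θ = 0
  s_mul_self : ∀ x, s x * s x = 0
  s_mul_w : ∀ x θ, s x * w θ = θ x • 1 - w θ * s x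

/-! ### Canonical anticommutation relations. -/

namespace CliffordPair

variable {𝔤 A B : Type*} [LieRing 𝔤] [LieAlgebra ℂ 𝔤] [Ring A] [Algebra ℂ A] [Ring B] [Algebra ℂ B]
  (C : CliffordPair 𝔤 A)

/-- Transport along an algebra homomorphism. -/
def map (φ : A →ₐ[ℂ] B) : CliffordPair 𝔤 B where
  w := φ.toLinearMap ∘ₗ C.w
  s := φ.toLinearMap ∘ₗ C.s
  w_mul_self θ := by simp [← map_mul, C.w_mul_self]
  s_mul_self x := by simp [← map_mul, C.s_mul_self]
  s_mul_w x θ := by simp [← map_mul, C.s_mul_w]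

@[simp] lemma map_w (φ : A →ₐ[ℂ] B) (θ : Dual ℂ 𝔤) : (C.map φ).w θ = φ (C.w θ) := rfl

@[simp] lemma map_s (φ : A →ₐ[ℂ] B) (x : 𝔤) : (C.map φ).s x = φ (C.s x) := rfl

lemma w_mul_comm (θ η : Dual ℂ 𝔤) : C.w θ * C.w η = -(C.w η * C.w θ) := by
  have h := C.w_mul_self (θ + η)
  simp only [map_add, mul_add, add_mul, w_mul_self, zero_add, add_zero] at h
  exact eq_neg_of_add_eq_zero_right h

lemma s_mul_comm (x y : 𝔤) : C.s x * C.s y = -(C.s y * C.s x) := by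
  have h := C.s_mul_self (x + y)
  simp only [map_add, mul_add, add_mul, s_mul_self, zero_add, add_zero] at h
  exact eq_neg_of_add_eq_zero_right h

lemma number_mul_w (θ η : Dual ℂ 𝔤) (x : 𝔤) :
    C.w θ * C.s x * C.w η = C.w η * (C.w θ * C.s x) + η x • C.w θ := by
  rw [mul_assoc, s_mul_w, mul_sub, ← mul_assoc, ← mul_assoc,
    C.w_mul_comm θ η, mul_smul_comm, mul_one, neg_mul]
  abel

lemma number_mul_s (θ : Dual ℂ 𝔤) (x y : 𝔤) :
    C.w θ * C.s x * C.s y = C.s y * (C.w θ * C.s x) - θ y • C.s x := by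
  rw [mul_assoc, C.s_mul_comm x y, ← mul_assoc (C.s y), s_mul_w, sub_mul,
    smul_mul_assoc, one_mul, mul_neg, ← mul_assoc]
  abel

/-! ### The Chevalley–Eilenberg differential as an element of the Clifford algebra. -/

section ChevalleyEilenberg

variable {ι : Type*} [Fintype ι] (e : Basis ι ℂ 𝔤)

lemma _root_.AnomalousBRST.sum_apply_smul_coord (θ : Dual ℂ 𝔤) :
    ∑ a, θ (e a) • e.coord a = θ := by
  classical
  refine e.ext fun b => ?_
  simp

/-- The coadjoint action on one-forms. -/
def _root_.AnomalousBRST.coad (x : 𝔤) : Dual ℂ 𝔤 →ₗ[ℂ] Dual ℂ 𝔤 :=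
  -(LieAlgebra.ad ℂ 𝔤 x).dualMap

lemma _root_.AnomalousBRST.coad_apply (x y : 𝔤) (θ : Dual ℂ 𝔤) : coad x θ y = -θ ⁅x, y⁆ := rfl

/-- The coadjoint action of `x` on the ghosts. -/
def act (x : 𝔤) : A := -∑ b, C.w (e.coord b) * C.s ⁅x, e b⁆

/-- Exterior multiplication by the two-form `dθ`. -/
def wd (θ : Dual ℂ 𝔤) : A :=
  -((1 / 2 : ℂ) • ∑ a, ∑ b, θ ⁅e a, e b⁆ • (C.w (e.coord a) * C.w (e.coord b)))

/-- The Chevalley–Eilenberg differential with trivial coefficients. -/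
def ceDiff : A := (1 / 2 : ℂ) • ∑ a, C.w (e.coord a) * C.act e (e a)

lemma w_coad (x : 𝔤) (θ : Dual ℂ 𝔤) :
    C.w (coad x θ) = -∑ b, θ ⁅x, e b⁆ • C.w (e.coord b) := by
  conv_lhs => rw [← sum_apply_smul_coord e (coad x θ)]
  simp [coad_apply]

lemma act_mul_w (x : 𝔤) (θ : Dual ℂ 𝔤) :
    C.act e x * C.w θ = C.w θ * C.act e x + C.w (coad x θ) := by
  simp only [act, neg_mul, mul_neg, Finset.sum_mul, Finset.mul_sum, number_mul_w,
    Finset.sum_add_distrib, C.w_coad e]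
  abel

lemma wd_eq (θ : Dual ℂ 𝔤) :
    C.wd e θ = (1 / 2 : ℂ) • ∑ a, C.w (e.coord a) * C.w (coad (e a) θ) := by
  simp only [wd, C.w_coad e, mul_neg, Finset.mul_sum, Finset.sum_neg_distrib, smul_neg,
    mul_smul_comm]

lemma wd_mul_w (θ η : Dual ℂ 𝔤) : C.wd e θ * C.w η = C.w η * C.wd e θ := by
  simp only [wd, neg_mul, mul_neg, smul_mul_assoc, mul_smul_comm, Finset.sum_mul,
    Finset.mul_sum]
  refine congrArg (fun z : A => -((1 / 2 : ℂ) • z)) ?_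
  refine Finset.sum_congr rfl fun a _ => Finset.sum_congr rfl fun b _ => ?_
  rw [mul_assoc, C.w_mul_comm _ η, mul_neg, ← mul_assoc, C.w_mul_comm _ η, neg_mul,
    neg_neg, mul_assoc]

/-- The differential is an odd derivation: its anticommutator with a one-form is the exterior
derivative of that form. -/
lemma ceDiff_mul_w (θ : Dual ℂ 𝔤) :
    C.ceDiff e * C.w θ = C.wd e θ - C.w θ * C.ceDiff e := by
  have h : ∀ a, C.w (e.coord a) * C.act e (e a) * C.w θ =
      C.w (e.coord a) * C.w (coad (e a) θ) - C.w θ * (C.w (e.coord a) * C.act e (e a)) := by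
    intro a
    rw [mul_assoc, act_mul_w, mul_add, ← mul_assoc, C.w_mul_comm _ θ, neg_mul, mul_assoc]
    abel
  simp only [ceDiff, wd_eq, smul_mul_assoc, mul_smul_comm, Finset.sum_mul, Finset.mul_sum, h,
    Finset.sum_sub_distrib, smul_sub]

/-- A product of three one-forms is invariant under cyclic rotation, so three times the sum can be
regrouped with Jacobi sums as coefficients. -/
lemma sum_lie_lie_smul (θ : Dual ℂ 𝔤) :
    ∑ a, ∑ b, ∑ c, θ ⁅e a, ⁅e b, e c⁆⁆ •
      (C.w (e.coord a) * (C.w (e.coord b) * C.w (e.coord c))) = 0 := by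
  set f : ι → ι → ι → A := fun a b c =>
    C.w (e.coord a) * (C.w (e.coord b) * C.w (e.coord c)) with hf
  have hcyc : ∀ a b c, f b c a = f a b c := by
    intro a b c
    simp only [hf]
    rw [C.w_mul_comm (e.coord c) (e.coord a), mul_neg, ← mul_assoc,
      C.w_mul_comm (e.coord b) (e.coord a), neg_mul, neg_neg, mul_assoc]
  have hrot : ∀ g : ι → ι → ι → A, ∑ a, ∑ b, ∑ c, g a b c = ∑ a, ∑ b, ∑ c, g b c a := by
    intro g
    rw [Finset.sum_comm_cycle]
  have h1 : ∑ a, ∑ b, ∑ c, θ ⁅e a, ⁅e b, e c⁆⁆ • f a b c =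
      ∑ a, ∑ b, ∑ c, θ ⁅e b, ⁅e c, e a⁆⁆ • f a b c := by
    rw [hrot]
    simp only [hcyc]
  have h2 : ∑ a, ∑ b, ∑ c, θ ⁅e a, ⁅e b, e c⁆⁆ • f a b c =
      ∑ a, ∑ b, ∑ c, θ ⁅e c, ⁅e a, e b⁆⁆ • f a b c := by
    rw [h1, hrot]
    simp only [hcyc]
  have h3 : (3 : ℂ) • ∑ a, ∑ b, ∑ c, θ ⁅e a, ⁅e b, e c⁆⁆ • f a b c = 0 := by
    have : (3 : ℂ) = 1 + 1 + 1 := by norm_num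
    rw [this, add_smul, add_smul, one_smul]
    nth_rewrite 2 [h1]
    nth_rewrite 2 [h2]
    simp only [← Finset.sum_add_distrib, ← add_smul, ← map_add, lie_jacobi, map_zero, zero_smul,
      Finset.sum_const_zero]
  exact (smul_eq_zero.mp h3).resolve_left (by norm_num)

/-- This is d(dθ) = 0: the commutator expands into ∑ θ[e_a, e_b] e^a ∧ de^b, which the Jacobi
identity annihilates. -/
lemma ceDiff_mul_wd (θ : Dual ℂ 𝔤) : C.ceDiff e * C.wd e θ = C.wd e θ * C.ceDiff e := by
  have hterm : ∀ a b, C.ceDiff e * (C.w (e.coord a) * C.w (e.coord b)) =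
      C.w (e.coord b) * C.wd e (e.coord a) - C.w (e.coord a) * C.wd e (e.coord b)
        + C.w (e.coord a) * C.w (e.coord b) * C.ceDiff e := by
    intro a b
    rw [← mul_assoc, ceDiff_mul_w, sub_mul, mul_assoc, ceDiff_mul_w, wd_mul_w, mul_sub, mul_assoc]
    abel
  have hswap : ∑ a, ∑ b, θ ⁅e a, e b⁆ • (C.w (e.coord b) * C.wd e (e.coord a)) =
      -∑ a, ∑ b, θ ⁅e a, e b⁆ • (C.w (e.coord a) * C.wd e (e.coord b)) := by
    rw [Finset.sum_comm]
    simp only [← Finset.sum_neg_distrib]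
    refine Finset.sum_congr rfl fun a _ => Finset.sum_congr rfl fun b _ => ?_
    rw [← lie_skew, map_neg, neg_smul]
  have hexp : ∀ a, ∑ b, θ ⁅e a, e b⁆ • (C.w (e.coord a) * C.wd e (e.coord b)) =
      -((1 / 2 : ℂ) • ∑ c, ∑ d, θ ⁅e a, ⁅e c, e d⁆⁆ •
        (C.w (e.coord a) * (C.w (e.coord c) * C.w (e.coord d)))) := by
    intro a
    have hθ : ∀ y, θ ⁅e a, y⁆ = ∑ b, θ ⁅e a, e b⁆ * e.coord b y := by
      intro y
      have := LinearMap.congr_fun (sum_apply_smul_coord e (θ ∘ₗ LieAlgebra.ad ℂ 𝔤 (e a))) y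
      simpa [LinearMap.sum_apply] using this.symm
    simp only [wd, mul_neg, mul_smul_comm, smul_neg, Finset.sum_neg_distrib, Finset.mul_sum,
      Finset.smul_sum, hθ ⁅_, _⁆, Finset.sum_smul]
    congr 1
    rw [Finset.sum_comm]
    refine Finset.sum_congr rfl fun c _ => ?_
    rw [Finset.sum_comm]
    refine Finset.sum_congr rfl fun d _ => Finset.sum_congr rfl fun b _ => ?_
    simp only [smul_smul]
    congr 1
    ring
  have hz : ∑ a, ∑ b, θ ⁅e a, e b⁆ • (C.w (e.coord a) * C.wd e (e.coord b)) = 0 := by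
    simp only [hexp, Finset.sum_neg_distrib, ← Finset.smul_sum, C.sum_lie_lie_smul e θ, smul_zero,
      neg_zero]
  conv_lhs => rw [wd]
  conv_rhs => rw [wd]
  simp only [mul_neg, neg_mul, mul_smul_comm, smul_mul_assoc, Finset.mul_sum, Finset.sum_mul,
    hterm, smul_add, smul_sub, Finset.sum_add_distrib, Finset.sum_sub_distrib]
  simp only [hswap, hz, smul_zero, neg_zero, sub_zero, zero_add]

lemma ceDiff_sq_mul_w (θ : Dual ℂ 𝔤) :
    C.ceDiff e * C.ceDiff e * C.w θ = C.w θ * (C.ceDiff e * C.ceDiff e) := by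
  rw [mul_assoc, ceDiff_mul_w, mul_sub, ceDiff_mul_wd, ← mul_assoc, ceDiff_mul_w, sub_mul]
  rw [mul_assoc]
  abel

lemma act_mem_span (x : 𝔤) : C.act e x ∈ Ideal.span (Set.range C.s) :=
  neg_mem <| sum_mem fun _ _ => Ideal.mul_mem_left _ _ (Ideal.subset_span ⟨_, rfl⟩)

lemma ceDiff_mem_span : C.ceDiff e ∈ Ideal.span (Set.range C.s) :=
  Submodule.smul_of_tower_mem _ _ <|
    sum_mem fun _ _ => Ideal.mul_mem_left _ _ (C.act_mem_span e _)

/-- An element of the left ideal of the substitutions which commutes with all exterior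
multiplications vanishes. -/
def IsFaithful : Prop :=
  ∀ a ∈ Ideal.span (Set.range C.s), (∀ θ, a * C.w θ = C.w θ * a) → a = 0

/-- Faithfulness spares the expansion of d²: it commutes with all one-forms and has a substitution
as its rightmost factor in every term. -/
lemma ceDiff_mul_self (hC : C.IsFaithful) : C.ceDiff e * C.ceDiff e = 0 :=
  hC _ (Ideal.mul_mem_left _ _ (C.ceDiff_mem_span e)) (C.ceDiff_sq_mul_w e)

lemma map_act (φ : A →ₐ[ℂ] B) (x : 𝔤) : (C.map φ).act e x = φ (C.act e x) := by
  simp [act]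

lemma map_ceDiff (φ : A →ₐ[ℂ] B) : (C.map φ).ceDiff e = φ (C.ceDiff e) := by
  simp [ceDiff, map_act]

/-- The square of the differential of a shifted representation. -/
lemma totalDiff_mul_self (hd : C.ceDiff e * C.ceDiff e = 0) (R : 𝔤 →ₗ[ℂ] A)
    (hR : ∀ x y, R ⁅x, y⁆ = R x * R y - R y * R x) (hw : ∀ x θ, R x * C.w θ = C.w θ * R x)
    (hs : ∀ x y, R x * C.s y = C.s y * R x) (θ : Dual ℂ 𝔤) :
    (∑ a, C.w (e.coord a) * R (e a) + C.ceDiff e - C.w θ) *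
      (∑ a, C.w (e.coord a) * R (e a) + C.ceDiff e - C.w θ) = -C.wd e θ := by
  set X := ∑ a, C.w (e.coord a) * R (e a) with hX
  set d := C.ceDiff e with hdd
  have hact : ∀ x y, R x * C.act e y = C.act e y * R x := by
    intro x y
    simp only [act, mul_neg, neg_mul, Finset.mul_sum, Finset.sum_mul]
    congr 1
    refine Finset.sum_congr rfl fun b _ => ?_
    rw [← mul_assoc, hw, mul_assoc, hs, mul_assoc]
  have hdR : ∀ x, R x * d = d * R x := by
    intro x
    simp only [hdd, ceDiff, mul_smul_comm, smul_mul_assoc, Finset.mul_sum, Finset.sum_mul]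
    congr 1
    refine Finset.sum_congr rfl fun b _ => ?_
    rw [← mul_assoc, hw, mul_assoc, hact, mul_assoc]
  have hXw : X * C.w θ = -(C.w θ * X) := by
    simp only [hX, Finset.mul_sum, Finset.sum_mul, ← Finset.sum_neg_distrib]
    refine Finset.sum_congr rfl fun b _ => ?_
    rw [mul_assoc, hw, ← mul_assoc, C.w_mul_comm, neg_mul, mul_assoc]
  -- The anticommutator of d and X is ∑ de^a R(e_a); the representation property makes X² its
  -- negative, so the two cancel in the square.
  have hXd : d * X = ∑ a, C.wd e (e.coord a) * R (e a) - X * d := by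
    simp only [hX, Finset.mul_sum, Finset.sum_mul, ← Finset.sum_sub_distrib]
    refine Finset.sum_congr rfl fun b _ => ?_
    rw [← mul_assoc, ceDiff_mul_w, sub_mul, mul_assoc _ _ d, hdR, mul_assoc]
  have hXX : X * X = -∑ a, C.wd e (e.coord a) * R (e a) := by
    have h1 : X * X = ∑ a, ∑ b, C.w (e.coord a) * C.w (e.coord b) * (R (e a) * R (e b)) := by
      simp only [hX, Finset.mul_sum, Finset.sum_mul]
      rw [Finset.sum_comm]
      refine Finset.sum_congr rfl fun a _ => Finset.sum_congr rfl fun b _ => ?_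
      rw [mul_assoc, ← mul_assoc (R _), hw]
      simp only [mul_assoc]
    have h2 : X * X = -∑ a, ∑ b, C.w (e.coord a) * C.w (e.coord b) * (R (e b) * R (e a)) := by
      rw [h1, Finset.sum_comm]
      simp only [← Finset.sum_neg_distrib]
      refine Finset.sum_congr rfl fun a _ => Finset.sum_congr rfl fun b _ => ?_
      rw [C.w_mul_comm, neg_mul]
    have hR' : ∀ y, R y = ∑ c, e.coord c y • R (e c) := by
      intro y
      conv_lhs => rw [← e.sum_repr y, map_sum]
      simp only [map_smul, Basis.coord_apply]
    have h3 : (2 : ℂ) • (X * X) =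
        ∑ a, ∑ b, ∑ c, e.coord c ⁅e a, e b⁆ • (C.w (e.coord a) * C.w (e.coord b) * R (e c)) := by
      rw [two_smul]
      nth_rewrite 1 [h1]
      rw [h2, ← sub_eq_add_neg]
      simp only [← Finset.sum_sub_distrib, ← mul_sub, ← hR]
      refine Finset.sum_congr rfl fun a _ => Finset.sum_congr rfl fun b _ => ?_
      rw [hR' ⁅e a, e b⁆]
      simp only [Finset.mul_sum, mul_smul_comm]
    have h4 : (2 : ℂ) • -∑ a, C.wd e (e.coord a) * R (e a) =
        ∑ a, ∑ b, ∑ c, e.coord c ⁅e a, e b⁆ • (C.w (e.coord a) * C.w (e.coord b) * R (e c)) := by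
      simp only [wd, neg_mul, Finset.sum_neg_distrib, neg_neg, smul_mul_assoc, Finset.sum_mul,
        ← Finset.smul_sum, smul_smul]
      rw [Finset.sum_comm_cycle, mul_one_div_cancel two_ne_zero, one_smul, Finset.sum_comm_cycle]
    exact smul_right_injective A (two_ne_zero' ℂ) (h3.trans h4.symm)
  have hdw := C.ceDiff_mul_w e θ
  rw [← hdd] at hdw
  simp only [add_mul, sub_mul, mul_add, mul_sub, hXX, hXd, hXw, hdw, hd, C.w_mul_self]
  abel

end ChevalleyEilenberg
end CliffordPair

/-! ### The Lefschetz argument for an sl₂ action. -/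

section Lefschetz

/-- Elements commuting with an idempotent split into two blocks and multiply blockwise. -/
lemma peirce_mul_peirce {A : Type*} [Ring A] {p a b a' b' : A} (hp : p * p = p) (ha : Commute p a) (hb : Commute p b)
    (haa : a * a' = 1) (hbb : b * b' = 1) :
    (p * a + (1 - p) * b) * (p * a' + (1 - p) * b') = 1 := by
  have hq : (1 - p) * (1 - p) = 1 - p := by simp [sub_mul, mul_sub, hp]
  have hpq : p * (1 - p) = 0 := by simp [mul_sub, hp]
  have hqp : (1 - p) * p = 0 := by simp [sub_mul, hp]
  have hqb : Commute (1 - p) b := (Commute.one_left _).sub_left hb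
  have hqa : Commute (1 - p) a := (Commute.one_left _).sub_left ha
  rw [ha.eq, hqb.eq, add_mul, mul_add, mul_add]
  simp only [mul_assoc, ← mul_assoc p, ← mul_assoc (1 - p), hp, hq, hpq, hqp, zero_mul, mul_zero,
    zero_add, add_zero]
  rw [← mul_assoc, ← ha.eq, mul_assoc, haa, ← mul_assoc, ← hqb.eq, mul_assoc, hbb]
  simp

variable {A : Type*} [Ring A] [Algebra ℂ A]

/-- A sum of n commuting idempotents has eigenvalues among 0, …, n. By induction: on the image of
the new idempotent s is replaced by s - 1, on its complement s is unchanged. -/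
lemma isUnit_sum_idempotents_sub {ι : Type*} (S : Finset ι) (P : ι → A)
    (hP : ∀ i, P i * P i = P i) (hc : ∀ i j, Commute (P i) (P j)) (s : ℝ) (hs : (S.card : ℝ) < s) :
    IsUnit (∑ i ∈ S, P i - (s : ℂ) • (1 : A)) := by
  classical
  induction S using Finset.induction_on generalizing s with
  | empty =>
    have hs0 : (s : ℂ) ≠ 0 := by
      simp only [Finset.card_empty, Nat.cast_zero] at hs
      exact_mod_cast hs.ne'
    rw [Finset.sum_empty, zero_sub]
    refine IsUnit.neg ?_
    rw [← Algebra.algebraMap_eq_smul_one]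
    exact (isUnit_iff_ne_zero.mpr hs0).map (algebraMap ℂ A)
  | insert i S hi ih =>
    rw [Finset.card_insert_of_notMem hi] at hs
    push_cast at hs
    rw [Finset.sum_insert hi]
    set K := ∑ j ∈ S, P j with hK
    have hPK : Commute (P i) K := Commute.sum_right _ _ _ fun j _ => hc i j
    obtain ⟨a, ha⟩ := ih (s - 1) (by linarith)
    obtain ⟨b, hb⟩ := ih s (by linarith)
    have hPa : Commute (P i) (a : A) := by
      rw [ha]; exact hPK.sub_right ((Commute.one_right _).smul_right _)
    have hPb : Commute (P i) (b : A) := by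
      rw [hb]; exact hPK.sub_right ((Commute.one_right _).smul_right _)
    have hPa' : Commute (P i) (↑a⁻¹ : A) := hPa.units_inv_right
    have hPb' : Commute (P i) (↑b⁻¹ : A) := hPb.units_inv_right
    have hsum : P i + K - (s : ℂ) • (1 : A) = P i * a + (1 - P i) * b := by
      rw [ha, hb]
      push_cast
      simp only [sub_smul, one_smul, mul_sub, sub_mul, mul_one, one_mul, mul_smul_comm]
      module
    have h1 : (P i * a + (1 - P i) * b) * (P i * ↑a⁻¹ + (1 - P i) * ↑b⁻¹) = 1 :=
      peirce_mul_peirce (hP i) hPa hPb a.mul_inv b.mul_inv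
    have h2 : (P i * ↑a⁻¹ + (1 - P i) * ↑b⁻¹) * (P i * a + (1 - P i) * b) = 1 :=
      peirce_mul_peirce (hP i) hPa' hPb' a.inv_mul b.inv_mul
    rw [hsum]
    exact ⟨⟨_, _, h1, h2⟩, rfl⟩

variable {N : Type*} [AddCommGroup N] [Module ℂ N]

/-- Surjectivity of the Lefschetz raising operator `E` in positive degrees: `E`, `F` generate an
`sl₂` whose weight is `G + c - K`, with `K` commuting with everything and bounded by `l`. -/
lemma exists_raising_eq (E F G K : End ℂ N) (c l : ℝ)
    (hEF : E * F - F * E = G + (c : ℂ) • 1 - K)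
    (hGE : G * E = E * G + (2 : ℂ) • E) (hGF : G * F = F * G - (2 : ℂ) • F)
    (hKE : Commute K E) (hKG : Commute K G)
    (hE : IsNilpotent E) (hK : ∀ s : ℝ, l < s → IsUnit (K - (s : ℂ) • 1))
    (r : ℝ) (hr : l < r + c) (u : N) (hu : G u = (r : ℂ) • u) :
    ∃ v, G v = ((r - 2 : ℝ) : ℂ) • v ∧ E v = u := by
  set h := G + (c : ℂ) • 1 - K with hh
  have hhE : h * E = E * h + (2 : ℂ) • E := by
    simp only [hh, add_mul, sub_mul, mul_add, mul_sub, hGE, hKE.eq, smul_mul_assoc, one_mul,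
      mul_smul_comm, mul_one]
    abel
  have hhpow : ∀ n : ℕ, h * E ^ n = E ^ n * h + (2 * n : ℂ) • E ^ n := by
    intro n
    induction n with
    | zero => simp
    | succ n ih =>
      rw [pow_succ, ← mul_assoc, ih, add_mul, mul_assoc, hhE, smul_mul_assoc, mul_add,
        mul_smul_comm, ← mul_assoc]
      push_cast
      rw [add_assoc, ← add_smul]
      congr 2
      ring
  -- The standard sl₂ commutation formula, with h the weight operator.
  have hpow : ∀ n : ℕ, E ^ (n + 1) * F =
      F * E ^ (n + 1) + ((n : ℂ) + 1) • (E ^ n * (h + (n : ℂ) • 1)) := by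
    intro n
    induction n with
    | zero => simp [← hEF]
    | succ n ih =>
      rw [pow_succ' E (n + 1), mul_assoc, ih, mul_add, ← mul_assoc, sub_eq_iff_eq_add.mp hEF,
        add_mul, mul_assoc F, mul_smul_comm, ← mul_assoc E (E ^ n), ← pow_succ' E n,
        ← pow_succ' E (n + 1), hhpow]
      simp only [mul_add, mul_smul_comm, mul_one]
      push_cast
      module
  have main : ∀ n : ℕ, ∀ u : N, G u = (r : ℂ) • u → (E ^ n) u = 0 →
      ∃ v, G v = ((r - 2 : ℝ) : ℂ) • v ∧ E v = u := by
    intro n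
    induction n with
    | zero =>
      intro u _ h0
      refine ⟨0, by simp, ?_⟩
      simpa using h0.symm
    | succ n ih =>
      intro u hu h0
      -- On the r-eigenspace of G, h + n equals -(K - (r + c + n)). This is invertible because r + c
      -- + n > l, and applying the inverse to u gives x with (h + n)x = -u.
      obtain ⟨k, hk⟩ := hK (r + c + n) (by have : (0 : ℝ) ≤ n := n.cast_nonneg
                                           linarith)
      have hkG : Commute (k : End ℂ N) G := by
        rw [hk]; exact hKG.sub_left ((Commute.one_left _).smul_left _)
      have hkE : Commute (k : End ℂ N) (E ^ (n + 1)) := by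
        rw [hk]; exact (hKE.sub_left ((Commute.one_left _).smul_left _)).pow_right _
      set x := (↑k⁻¹ : End ℂ N) u with hx
      have hGx : G x = (r : ℂ) • x := by
        have := LinearMap.congr_fun hkG.units_inv_left.eq u
        simp only [Module.End.mul_apply, hu, map_smul] at this
        exact this.symm
      have hEx : (E ^ (n + 1)) x = 0 := by
        have := LinearMap.congr_fun hkE.units_inv_left.eq u
        simp only [Module.End.mul_apply, h0, map_zero] at this
        exact this.symm
      have hkx : (k : End ℂ N) x = u := by
        rw [hx, ← Module.End.mul_apply, Units.mul_inv, Module.End.one_apply]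
      have hhx : h x + (n : ℂ) • x = -u := by
        rw [← hkx, hk]
        simp only [hh, LinearMap.add_apply, LinearMap.sub_apply, LinearMap.smul_apply,
          Module.End.one_apply, hGx]
        push_cast
        module
      -- By `hpow` the vector EFx + (n+1)u is killed by one power of E fewer, so the induction
      -- hypothesis puts it in the image of E, and u with it.
      have hcas : (E ^ n) (E (F x) + ((n : ℂ) + 1) • u) = 0 := by
        have := LinearMap.congr_fun (hpow n) x
        simp only [pow_succ, Module.End.mul_apply, LinearMap.add_apply, LinearMap.smul_apply,
          Module.End.one_apply, hhx, map_neg] at this hEx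
        rw [map_add, this, map_smul, hEx]
        simp
      have hGFx : G (F x) = ((r - 2 : ℝ) : ℂ) • F x := by
        have := LinearMap.congr_fun hGF x
        simp only [Module.End.mul_apply, LinearMap.sub_apply, LinearMap.smul_apply, hGx,
          map_smul] at this
        rw [this]
        push_cast
        module
      have hGEF : G (E (F x) + ((n : ℂ) + 1) • u) = (r : ℂ) • (E (F x) + ((n : ℂ) + 1) • u) := by
        have := LinearMap.congr_fun hGE (F x)
        simp only [Module.End.mul_apply, LinearMap.add_apply, LinearMap.smul_apply, hGFx,
          map_smul] at this
        rw [map_add, this, map_smul, hu]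
        push_cast
        module
      obtain ⟨v, hv, hEv⟩ := ih _ hGEF hcas
      have hn : ((n : ℂ) + 1) ≠ 0 := by exact_mod_cast n.succ_ne_zero
      refine ⟨((n : ℂ) + 1)⁻¹ • (v - F x), ?_, ?_⟩
      · rw [map_smul, map_sub, hv, hGFx]
        module
      · rw [map_smul, map_sub, hEv, add_sub_cancel_left, smul_smul, inv_mul_cancel₀ hn, one_smul]
  obtain ⟨n, hn⟩ := hE
  exact main n u hu (by rw [hn]; rfl)

end Lefschetz

/-! ### The form degree. -/

namespace CliffordPair

variable {𝔤 A : Type*} [LieRing 𝔤] [LieAlgebra ℂ 𝔤] [Ring A] [Algebra ℂ A]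
  (C : CliffordPair 𝔤 A) {ι : Type*} [Fintype ι] (e : Basis ι ℂ 𝔤)

/-- The degree operator on forms. -/
def number : A := ∑ a, C.w (e.coord a) * C.s (e a)

lemma number_mul_w' (θ : Dual ℂ 𝔤) :
    C.number e * C.w θ = C.w θ * C.number e + C.w θ := by
  have h : C.w θ = ∑ a, θ (e a) • C.w (e.coord a) := by
    conv_lhs => rw [← sum_apply_smul_coord e θ, map_sum]
    simp only [map_smul]
  simp only [number, Finset.sum_mul, Finset.mul_sum, number_mul_w, Finset.sum_add_distrib, ← h]

lemma number_mul_s' (x : 𝔤) :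
    C.number e * C.s x = C.s x * C.number e - C.s x := by
  have h : C.s x = ∑ a, e.coord a x • C.s (e a) := by
    conv_lhs => rw [← e.sum_repr x, map_sum]
    simp only [map_smul, Basis.coord_apply]
  simp only [number, Finset.sum_mul, Finset.mul_sum, number_mul_s, Finset.sum_sub_distrib, ← h]

lemma number_commute_act (x : 𝔤) : Commute (C.number e) (C.act e x) := by
  refine Commute.neg_right (Commute.sum_right _ _ _ fun b _ => ?_)
  rw [Commute, SemiconjBy, ← mul_assoc, number_mul_w', add_mul, mul_assoc, number_mul_s', mul_sub,
    sub_add_cancel, mul_assoc]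

lemma number_mul_ceDiff : C.number e * C.ceDiff e = C.ceDiff e * C.number e + C.ceDiff e := by
  simp only [ceDiff, mul_smul_comm, smul_mul_assoc, Finset.mul_sum, Finset.sum_mul, ← smul_add,
    ← Finset.sum_add_distrib]
  congr 1
  refine Finset.sum_congr rfl fun a _ => ?_
  rw [← mul_assoc, number_mul_w', add_mul, mul_assoc, (C.number_commute_act e _).eq, mul_assoc]

end CliffordPair

/-! ### Positivity on coroots, and the sum of the positive roots. -/

section Positivity

variable {ι M N : Type*} [Fintype ι] [AddCommGroup M] [Module ℂ M] [AddCommGroup N] [Module ℂ N]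
  {P : RootPairing ι ℂ M N} [P.IsCrystallographic]

/-- The value is a sum of squares of Cartan integers, one of which is 2² from the root itself. -/
lemma rootForm_root_self_pos (P : RootPairing ι ℂ M N) [P.IsCrystallographic] (i : ι) :
    ∃ t : ℝ, 0 < t ∧ P.RootForm (P.root i) (P.root i) = t := by
  refine ⟨∑ j, (P.pairingIn ℤ i j : ℝ) * P.pairingIn ℤ i j, ?_, ?_⟩
  · refine Finset.sum_pos' (fun j _ => mul_self_nonneg _) ⟨i, Finset.mem_univ _, ?_⟩
    simp
  · rw [P.rootForm_root_self]
    push_cast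
    refine Finset.sum_congr rfl fun j _ => ?_
    rw [← P.algebraMap_pairingIn ℤ i j]
    simp

/-- A functional which is positive on the simple coroots is positive on all positive coroots. -/
lemma coroot_pos_of_isPos {b : P.Base} (f : N →ₗ[ℂ] ℂ)
    (hf : ∀ i ∈ b.support, ∃ t : ℝ, 0 < t ∧ f (P.coroot i) = t) {i : ι} (hi : b.IsPos i) :
    ∃ t : ℝ, 0 < t ∧ f (P.coroot i) = t := by
  -- Coroots are not additive in the roots, but the polarization is, and it is a positive multiple
  -- of the coroot. Positivity can therefore be propagated by adding simple roots.
  have hpol : ∀ j, P.RootForm (P.root j) (P.root j) * f (P.coroot j) =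
      2 * f (P.Polarization (P.root j)) := by
    intro j
    have := congrArg f (P.rootForm_self_smul_coroot j)
    simpa using this
  have hsimple : ∀ j ∈ b.support, ∃ t : ℝ, 0 < t ∧ f (P.Polarization (P.root j)) = t := by
    intro j hj
    obtain ⟨s, hs, hs'⟩ := rootForm_root_self_pos P j
    obtain ⟨t, ht, ht'⟩ := hf j hj
    refine ⟨s * t / 2, by positivity, ?_⟩
    have := hpol j
    rw [hs', ht'] at this
    push_cast
    rw [this]
    ring
  have hpos : ∃ t : ℝ, 0 < t ∧ f (P.Polarization (P.root i)) = t := by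
    refine hi.induction_on_add hsimple ?_
    rintro j k m hm ⟨t, ht, ht'⟩ hk
    obtain ⟨s, hs, hs'⟩ := hsimple k hk
    exact ⟨t + s, by positivity, by rw [hm, map_add, map_add, ht', hs']; push_cast; rfl⟩
  obtain ⟨s, hs, hs'⟩ := rootForm_root_self_pos P i
  obtain ⟨t, ht, ht'⟩ := hpos
  refine ⟨2 * t / s, by positivity, ?_⟩
  have := hpol i
  rw [hs', ht'] at this
  have hs0 : (s : ℂ) ≠ 0 := by exact_mod_cast hs.ne'
  push_cast
  rw [eq_div_iff hs0, mul_comm, this]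

/-- The sum of the positive roots takes the value `2` on each simple coroot. -/
lemma sum_isPos_pairing [P.IsReduced] {b : P.Base} {S : Finset ι} (hS : ∀ j, j ∈ S ↔ b.IsPos j)
    {i : ι} (hi : i ∈ b.support) : ∑ j ∈ S, P.pairing j i = 2 := by
  classical
  have hiS : i ∈ S := (hS i).mpr (b.isPos_of_mem_support hi)
  rw [← Finset.add_sum_erase S _ hiS, P.pairing_same]
  -- A simple reflection permutes the other positive roots while negating their pairing with its
  -- coroot, so they contribute nothing and only the simple root itself is left.
  have hrefl : ∀ j ∈ S.erase i, P.reflectionPerm i j ∈ S.erase i := by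
    intro j hj
    rw [Finset.mem_erase, hS] at hj
    have hpos : b.IsPos (P.reflectionPerm i j) := hj.2.reflectionPerm hi hj.1
    rw [Finset.mem_erase, hS]
    refine ⟨fun h => ?_, hpos⟩
    have hj' : j = P.reflectionPerm i i := by
      rw [← P.reflectionPerm_self i j, h]
    let := P.indexNeg
    have h1 := (RootPairing.Base.IsPos.neg_iff_not b i).mp (by
      rw [P.indexNeg_neg, ← hj']; exact hj.2)
    exact h1 (b.isPos_of_mem_support hi)
  have hsum : ∑ j ∈ S.erase i, P.pairing j i = ∑ j ∈ S.erase i, -P.pairing j i := by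
    refine Finset.sum_nbij' (P.reflectionPerm i) (P.reflectionPerm i) hrefl hrefl
      (fun j _ => P.reflectionPerm_self i j) (fun j _ => P.reflectionPerm_self i j) fun j _ => ?_
    rw [← P.pairing_reflectionPerm, P.pairing_reflectionPerm_self_right, neg_neg]
  rw [Finset.sum_neg_distrib, self_eq_neg] at hsum
  rw [hsum, add_zero]

/-- A functional which is positive on the simple coroots stays nonzero on the positive coroots
after adding the sum of the positive roots. -/
lemma add_sum_isPos_coroot_ne_zero [P.IsReduced] {b : P.Base} {S : Finset ι}
    (hS : ∀ j, j ∈ S ↔ b.IsPos j) (f : N →ₗ[ℂ] ℂ)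
    (hf : ∀ i ∈ b.support, ∃ t : ℝ, 0 < t ∧ f (P.coroot i) = t) {i : ι} (hi : b.IsPos i) :
    f (P.coroot i) + ∑ j ∈ S, P.pairing j i ≠ 0 := by
  obtain ⟨t, ht, h⟩ := coroot_pos_of_isPos (f + ∑ j ∈ S, P.root' j) (fun k hk => by
    obtain ⟨t, ht, h⟩ := hf k hk
    refine ⟨t + 2, by positivity, ?_⟩
    simp [LinearMap.sum_apply, h, sum_isPos_pairing hS hk]) hi
  simp only [LinearMap.add_apply, LinearMap.sum_apply] at h
  have h' : f (P.coroot i) + ∑ j ∈ S, P.pairing j i = t := h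
  rw [h']
  exact_mod_cast ht.ne'

end Positivity

/-! ### Symplectic raising and lowering operators. -/

namespace CliffordPair

variable {𝔤 A : Type*} [LieRing 𝔤] [LieAlgebra ℂ 𝔤] [Ring A] [Algebra ℂ A]
  (C : CliffordPair 𝔤 A)

lemma w_mul_w_mul_w (θ η ζ : Dual ℂ 𝔤) :
    C.w θ * C.w η * C.w ζ = C.w ζ * (C.w θ * C.w η) := by
  rw [mul_assoc, C.w_mul_comm η ζ, mul_neg, ← mul_assoc, C.w_mul_comm θ ζ, neg_mul, neg_neg,
    mul_assoc]

lemma w_mul_w_mul_s (θ η : Dual ℂ 𝔤) (y : 𝔤) :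
    C.w θ * C.w η * C.s y = C.s y * (C.w θ * C.w η) + η y • C.w θ - θ y • C.w η := by
  have h : ∀ ζ, C.w ζ * C.s y = ζ y • 1 - C.s y * C.w ζ := fun ζ => by rw [C.s_mul_w]; abel
  rw [mul_assoc, h, mul_sub, ← mul_assoc, h, sub_mul, mul_smul_comm, mul_one, smul_mul_assoc,
    one_mul, mul_assoc]
  abel

lemma commute_w_mul_w (θ η ζ ξ : Dual ℂ 𝔤) :
    Commute (C.w θ * C.w η) (C.w ζ * C.w ξ) :=
  Commute.mul_right (C.w_mul_w_mul_w θ η ζ) (C.w_mul_w_mul_w θ η ξ)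

lemma w_mul_w_sq (θ η : Dual ℂ 𝔤) : (C.w θ * C.w η) * (C.w θ * C.w η) = 0 := by
  rw [← mul_assoc, w_mul_w_mul_w, ← mul_assoc, C.w_mul_self, zero_mul, zero_mul]

section Darboux

variable {κ : Type*} (S : Finset κ) (p q : κ → Dual ℂ 𝔤) (x y : κ → 𝔤) (m : κ → ℂ)

/-- The symplectic raising operator `∑ m_k p_k ∧ q_k`. -/
def raising : A := ∑ k ∈ S, m k • (C.w (p k) * C.w (q k))

/-- The symplectic lowering operator. -/
def lowering : A := ∑ k ∈ S, (m k)⁻¹ • (C.s (y k) * C.s (x k))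

lemma isNilpotent_raising : IsNilpotent (C.raising S p q m) := by
  refine Commute.isNilpotent_sum (fun k _ => ⟨2, ?_⟩) fun j k _ _ => ?_
  · rw [pow_two, smul_mul_smul_comm, w_mul_w_sq, smul_zero]
  · exact ((C.commute_w_mul_w _ _ _ _).smul_left _).smul_right _

/-- Different hyperbolic planes commute; within one plane the coefficients m and m⁻¹ cancel. -/
lemma raising_lowering (hm : ∀ k ∈ S, m k ≠ 0)
    (hpx : ∀ j k, j ≠ k → p j (x k) = 0) (hqy : ∀ j k, j ≠ k → q j (y k) = 0)
    (hpx1 : ∀ k, p k (x k) = 1) (hqy1 : ∀ k, q k (y k) = 1)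
    (hpy : ∀ j ∈ S, ∀ k ∈ S, p j (y k) = 0) (hqx : ∀ j ∈ S, ∀ k ∈ S, q j (x k) = 0) :
    C.raising S p q m * C.lowering S x y m - C.lowering S x y m * C.raising S p q m =
      ∑ k ∈ S, (C.w (p k) * C.s (x k) + C.w (q k) * C.s (y k) - 1) := by
  classical
  have hterm : ∀ j ∈ S, ∀ k ∈ S, (C.w (p j) * C.w (q j)) * (C.s (y k) * C.s (x k)) -
      (C.s (y k) * C.s (x k)) * (C.w (p j) * C.w (q j)) =
      if j = k then C.w (p k) * C.s (x k) + C.w (q k) * C.s (y k) - 1 else 0 := by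
    intro j hj k hk
    rw [← mul_assoc, w_mul_w_mul_s, hpy j hj k hk, zero_smul, sub_zero, add_mul, smul_mul_assoc,
      mul_assoc (C.s (y k)), w_mul_w_mul_s, hqx j hj k hk, zero_smul, add_zero]
    split_ifs with h
    · subst h
      rw [hqy1, hpx1, one_smul, one_smul, mul_sub, s_mul_w, hqy1, one_smul, mul_assoc]
      abel
    · rw [hqy j k h, hpx j k h]
      simp [mul_assoc]
  simp only [raising, lowering, Finset.sum_mul, Finset.mul_sum]
  rw [Finset.sum_comm (s := S) (t := S), ← Finset.sum_sub_distrib]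
  refine Finset.sum_congr rfl fun k hk => ?_
  rw [← Finset.sum_sub_distrib, Finset.sum_eq_single_of_mem k hk]
  · have := hterm k hk k hk
    rw [if_pos rfl] at this
    rw [smul_mul_smul_comm, smul_mul_smul_comm, mul_comm (m k)⁻¹, mul_inv_cancel₀ (hm k hk),
      one_smul, one_smul, this]
  · intro j hj hjk
    have := hterm k hk j hj
    rw [if_neg hjk.symm] at this
    rw [smul_mul_smul_comm, smul_mul_smul_comm, mul_comm (m j)⁻¹, ← smul_sub, this, smul_zero]

end Darboux

end CliffordPair

/-! ### Opposite and positive roots. -/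

section RootData

variable {𝔤 : Type*} [LieRing 𝔤] [LieAlgebra ℂ 𝔤] [FiniteDimensional ℂ 𝔤]
  {H : LieSubalgebra ℂ 𝔤} [H.IsCartanSubalgebra]

lemma root_ext {α β : H.root} (h : ∀ x : H, α.1 x = β.1 x) : α = β :=
  Subtype.ext (DFunLike.ext _ _ h)

lemma exists_root_apply_ne_zero (α : H.root) : ∃ h : H, α.1 h ≠ 0 := by
  by_contra! hc
  have h2 := α.2
  simp only [Finset.mem_filter, Finset.mem_univ, true_and] at h2
  exact h2 (funext hc)

variable [IsKilling ℂ 𝔤]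

lemma negRoot_apply (α : H.root) (h : H) : (negRoot α).1 h = -α.1 h := rfl

@[simp] lemma negRoot_negRoot (α : H.root) : negRoot (negRoot α) = α := by
  refine Subtype.ext (DFunLike.ext _ _ fun h => ?_)
  simp [negRoot_apply]

lemma coroot_negRoot (α : H.root) : coroot (negRoot α).1 = -coroot α.1 := coroot_neg α.1

lemma mem_posRoots {Δ : (rootSystem H).Base} {α : H.root} : α ∈ posRoots Δ ↔ Δ.IsPos α := by
  simp [posRoots]

lemma negRoot_mem_posRoots {Δ : (rootSystem H).Base} {α : H.root} :
    negRoot α ∈ posRoots Δ ↔ α ∉ posRoots Δ := by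
  let := (rootSystem H).indexNeg
  have h := RootPairing.Base.IsPos.neg_iff_not Δ α
  have h' : -α = negRoot α := by
    refine (rootSystem H).root.injective ?_
    rw [RootPairing.indexNeg_neg, RootPairing.root_reflectionPerm,
      RootPairing.reflection_apply_self]
    rfl
  rw [h'] at h
  rw [mem_posRoots, mem_posRoots, h]

lemma sum_root_eq {A : Type*} [AddCommMonoid A] (Δ : (rootSystem H).Base) (f : H.root → A) :
    ∑ α, f α = ∑ α ∈ posRoots Δ, f α + ∑ α ∈ posRoots Δ, f (negRoot α) := by
  classical
  rw [← Finset.sum_add_sum_compl (posRoots Δ) f]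
  congr 1
  refine Finset.sum_nbij' negRoot negRoot ?_ ?_ (fun α _ => negRoot_negRoot α)
    (fun α _ => negRoot_negRoot α) fun α _ => by rw [negRoot_negRoot]
  · intro α hα
    rw [negRoot_mem_posRoots]
    exact Finset.mem_compl.mp hα
  · intro α hα
    rw [Finset.mem_compl, negRoot_mem_posRoots]
    exact not_not_intro hα

end RootData

/-! ### Brackets in a root basis, and the form 2ρ. -/

namespace RootBasis

variable {𝔤 : Type*} [LieRing 𝔤] [LieAlgebra ℂ 𝔤] [FiniteDimensional ℂ 𝔤] [IsKilling ℂ 𝔤]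
  {H : LieSubalgebra ℂ 𝔤} [H.IsCartanSubalgebra] (T : RootBasis H)

/-- The form dual to `H_i`. -/
abbrev cartanForm (i : Fin (finrank ℂ H)) : Dual ℂ 𝔤 := T.toBasis.coord (Sum.inl i)

/-- The form dual to `τ_α`. -/
abbrev rootForm (α : H.root) : Dual ℂ 𝔤 := T.toBasis.coord (Sum.inr α)

lemma cartanForm_cartan (i j : Fin (finrank ℂ H)) :
    T.cartanForm i (T.cartan j) = if i = j then 1 else 0 := by
  classical
  rw [cartanForm, cartan, Basis.coord_apply, Basis.repr_self, Finsupp.single_apply]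
  simp [eq_comm]

@[simp] lemma cartanForm_rootVec (i : Fin (finrank ℂ H)) (α : H.root) :
    T.cartanForm i (T.rootVec α) = 0 := by
  simp [rootVec]

@[simp] lemma rootForm_cartan (α : H.root) (i : Fin (finrank ℂ H)) :
    T.rootForm α (T.cartan i) = 0 := by
  simp [cartan]

lemma rootForm_rootVec [DecidableEq H.root] (α β : H.root) :
    T.rootForm α (T.rootVec β) = if α = β then 1 else 0 := by
  simp [rootVec, Finsupp.single_apply, eq_comm]

lemma sum_repr (x : 𝔤) :
    x = ∑ i, T.cartanForm i x • T.cartan i + ∑ α, T.rootForm α x • T.rootVec α := by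
  conv_lhs => rw [← T.toBasis.sum_repr x, Fintype.sum_sum_type]
  rfl

lemma lie_cartan (h : H) (i : Fin (finrank ℂ H)) : ⁅(h : 𝔤), T.cartan i⁆ = 0 := by
  have := trivial_lie_zero H H h ⟨T.cartan i, T.cartan_mem i⟩
  exact congrArg Subtype.val this

lemma lie_rootVec (h : H) (α : H.root) : ⁅(h : 𝔤), T.rootVec α⁆ = α.1 h • T.rootVec α :=
  lie_eq_smul_of_mem_rootSpace (T.root_mem α) h

lemma lie_eq (h : H) (x : 𝔤) : ⁅(h : 𝔤), x⁆ = ∑ α, (T.rootForm α x * α.1 h) • T.rootVec α := by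
  conv_lhs => rw [T.sum_repr x]
  simp only [lie_add, lie_sum, lie_smul, lie_cartan, lie_rootVec, smul_zero, Finset.sum_const_zero,
    zero_add, smul_smul]

lemma cartanForm_lie (h : H) (x : 𝔤) (i : Fin (finrank ℂ H)) :
    T.cartanForm i ⁅(h : 𝔤), x⁆ = 0 := by
  rw [T.lie_eq]
  simp only [map_sum, map_smul, cartanForm_rootVec, smul_zero, Finset.sum_const_zero]

lemma rootForm_lie (h : H) (x : 𝔤) (α : H.root) :
    T.rootForm α ⁅(h : 𝔤), x⁆ = α.1 h * T.rootForm α x := by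
  classical
  rw [T.lie_eq]
  simp only [map_sum, map_smul, rootForm_rootVec, smul_eq_mul, mul_ite, mul_one, mul_zero]
  rw [Finset.sum_ite_eq]
  simp [mul_comm]

/-- An element of the abelian H has weight zero, hence no component along a nonzero root. -/
lemma rootForm_coe (h : H) (α : H.root) : T.rootForm α (h : 𝔤) = 0 := by
  obtain ⟨k, hk⟩ := exists_root_apply_ne_zero α
  have h1 := T.rootForm_lie k (h : 𝔤) α
  have h2 : ⁅(k : 𝔤), (h : 𝔤)⁆ = 0 := congrArg Subtype.val (trivial_lie_zero H H k h)
  rw [h2, map_zero, eq_comm, mul_eq_zero] at h1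
  exact h1.resolve_left hk

lemma coe_eq_sum (h : H) : (h : 𝔤) = ∑ i, T.cartanForm i (h : 𝔤) • T.cartan i := by
  conv_lhs => rw [T.sum_repr (h : 𝔤)]
  simp only [rootForm_coe, zero_smul, Finset.sum_const_zero, add_zero]

lemma sum_cartanForm_mul_rootVal (h : H) (α : H.root) :
    ∑ i, T.cartanForm i (h : 𝔤) * T.rootVal α i = α.1 h := by
  have : h = ∑ i, T.cartanForm i (h : 𝔤) • (⟨T.cartan i, T.cartan_mem i⟩ : H) := by
    refine Subtype.ext ?_
    conv_lhs => rw [T.coe_eq_sum h]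
    simp
  have h2 := congrArg (LieModule.Weight.toLinear ℂ H 𝔤 α.1) this
  simp only [map_sum, map_smul] at h2
  exact h2.symm

lemma cartanForm_eq_zero_of_mem {x : 𝔤} {f : H → ℂ} (hx : x ∈ rootSpace H f) {h : H}
    (hf : f h ≠ 0) (i : Fin (finrank ℂ H)) : T.cartanForm i x = 0 := by
  have h1 := T.cartanForm_lie h x i
  have h2 : ⁅(h : 𝔤), x⁆ = f h • x := lie_eq_smul_of_mem_rootSpace hx h
  rw [h2, map_smul, smul_eq_mul, mul_eq_zero] at h1
  exact h1.resolve_left hf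

lemma lie_rootVec_cartan (α : H.root) (i : Fin (finrank ℂ H)) :
    ⁅T.rootVec α, T.cartan i⁆ = -(T.rootVal α i • T.rootVec α) := by
  rw [← lie_skew]
  exact congrArg Neg.neg (T.lie_rootVec ⟨T.cartan i, T.cartan_mem i⟩ α)

lemma coroot_eq_sum (α : H.root) :
    ((coroot α.1 : H) : 𝔤) = ∑ i, T.corootCoord α i • T.cartan i := T.coe_eq_sum _

lemma lie_rootVec_rootVec [DecidableEq H.root] (α β : H.root) :
    ⁅T.rootVec α, T.rootVec β⁆ = ∑ γ, T.structConst α β γ • T.rootVec γ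
      - if β = negRoot α then ∑ i, T.corootCoord α i • T.cartan i else 0 := by
  split_ifs with h
  · subst h
    have h1 : ⁅T.rootVec α, T.rootVec (negRoot α)⁆ = -((coroot α.1 : H) : 𝔤) := T.lie_neg α
    have h2 : ∀ γ, T.structConst α (negRoot α) γ = 0 := by
      intro γ
      have := T.rootForm_coe (coroot α.1) γ
      rw [structConst, h1, map_neg, neg_eq_zero]
      exact this
    simp only [h1, h2, zero_smul, Finset.sum_const_zero, zero_sub, T.coroot_eq_sum α]
  · have hmem : ⁅T.rootVec α, T.rootVec β⁆ ∈ rootSpace H (α.1 + β.1 : H → ℂ) :=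
      lie_mem_genWeightSpace_of_mem_genWeightSpace (T.root_mem α) (T.root_mem β)
    have hne : ∃ k : H, (α.1 + β.1 : H → ℂ) k ≠ 0 := by
      by_contra! hc
      refine h (root_ext fun k => ?_)
      rw [negRoot_apply, eq_neg_iff_add_eq_zero, add_comm]
      exact hc k
    obtain ⟨k, hk⟩ := hne
    rw [sub_zero]
    conv_lhs => rw [T.sum_repr ⁅T.rootVec α, T.rootVec β⁆]
    simp only [T.cartanForm_eq_zero_of_mem hmem hk, zero_smul, Finset.sum_const_zero, zero_add]
    rfl

/-- The bracket has weight α + β, which differs from α since β ≠ 0. -/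
lemma structConst_self (α β : H.root) : T.structConst α β α = 0 := by
  have hmem : ⁅T.rootVec α, T.rootVec β⁆ ∈ rootSpace H (α.1 + β.1 : H → ℂ) :=
    lie_mem_genWeightSpace_of_mem_genWeightSpace (T.root_mem α) (T.root_mem β)
  obtain ⟨k, hk⟩ := exists_root_apply_ne_zero β
  have h1 := T.rootForm_lie k ⁅T.rootVec α, T.rootVec β⁆ α
  have h2 : ⁅(k : 𝔤), ⁅T.rootVec α, T.rootVec β⁆⁆ = (α.1 k + β.1 k) • ⁅T.rootVec α, T.rootVec β⁆ :=
    lie_eq_smul_of_mem_rootSpace hmem k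
  rw [h2, map_smul, smul_eq_mul, add_mul, add_eq_left, mul_eq_zero] at h1
  exact h1.resolve_left hk

/-- The sum of the positive roots, extended by zero to a one-form on `𝔤`. -/
def twoRho (Δ : (rootSystem H).Base) : Dual ℂ 𝔤 :=
  ∑ β ∈ posRoots Δ, ∑ i, T.rootVal β i • T.cartanForm i

lemma twoRho_rootVec (Δ : (rootSystem H).Base) (α : H.root) : T.twoRho Δ (T.rootVec α) = 0 := by
  simp only [twoRho, LinearMap.sum_apply, LinearMap.smul_apply, cartanForm_rootVec, smul_zero,
    Finset.sum_const_zero]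

lemma twoRho_coroot (Δ : (rootSystem H).Base) (α : H.root) :
    T.twoRho Δ ((coroot α.1 : H) : 𝔤) = ∑ β ∈ posRoots Δ, (rootSystem H).pairing β α := by
  simp only [twoRho, LinearMap.sum_apply, LinearMap.smul_apply, smul_eq_mul]
  refine Finset.sum_congr rfl fun β _ => ?_
  rw [rootSystem_pairing_apply, ← T.sum_cartanForm_mul_rootVal]
  exact Finset.sum_congr rfl fun i _ => mul_comm _ _

lemma add_twoRho_coroot_ne_zero (Δ : (rootSystem H).Base) (χ : Dual ℂ 𝔤)
    (hχ : IsRegularDominant Δ χ) {α : H.root} (hα : α ∈ posRoots Δ) :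
    (χ + T.twoRho Δ) ((coroot α.1 : H) : 𝔤) ≠ 0 := by
  rw [LinearMap.add_apply, twoRho_coroot]
  exact add_sum_isPos_coroot_ne_zero (fun _ => mem_posRoots) (χ ∘ₗ H.toSubmodule.subtype) hχ.2
    (mem_posRoots.mp hα)

end RootBasis

/-! ### Normal ordering, ghost number and the two-form dλ. -/

namespace CliffordPair

variable {𝔤 : Type*} [LieRing 𝔤] [LieAlgebra ℂ 𝔤] [FiniteDimensional ℂ 𝔤] [IsKilling ℂ 𝔤]
  {H : LieSubalgebra ℂ 𝔤} [H.IsCartanSubalgebra] {A : Type*} [Ring A] [Algebra ℂ A]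
  (C : CliffordPair 𝔤 A) (T : RootBasis H) (Δ : (rootSystem H).Base)

/-- `RootBasis.c` for an arbitrary representation of the ghost algebra. -/
def c (α : H.root) : A := C.w (T.rootForm (negRoot α))

/-- `RootBasis.ghostRoot` for an arbitrary representation of the ghost algebra. -/
def ghostRoot (α : H.root) : A :=
  -(∑ β : H.root, ∑ γ : H.root, T.structConst α β γ • (C.c T (negRoot β) * C.s (T.rootVec γ)))
    + ∑ i, T.corootCoord α i • (C.c T α * C.s (T.cartan i))
    + ∑ i, T.rootVal α i • (C.w (T.cartanForm i) * C.s (T.rootVec α))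

/-- `RootBasis.ghostCartan` for an arbitrary representation of the ghost algebra. -/
def ghostCartan (i : Fin (finrank ℂ H)) : A :=
  -(∑ β ∈ posRoots Δ, T.rootVal β i • (C.c T (negRoot β) * C.s (T.rootVec β)))
    - ∑ β ∈ posRoots Δ, T.rootVal β i • (C.s (T.rootVec (negRoot β)) * C.c T β)

/-- `RootBasis.ghostDiff` for an arbitrary representation of the ghost algebra. -/
def ghostDiff : A :=
  (1 / 2 : ℂ) • (∑ α ∈ posRoots Δ, C.c T (negRoot α) * C.ghostRoot T α)
    + (1 / 2 : ℂ) • (∑ α ∈ posRoots Δ, C.ghostRoot T (negRoot α) * C.c T α)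
    + (1 / 2 : ℂ) • (∑ i, C.w (T.cartanForm i) * C.ghostCartan T Δ i)

/-- `RootBasis.ghostNumber` for an arbitrary representation of the ghost algebra. -/
def ghostNumber : A :=
  (∑ α ∈ posRoots Δ, C.c T (negRoot α) * C.s (T.rootVec α))
    - (∑ α ∈ posRoots Δ, C.s (T.rootVec (negRoot α)) * C.c T α)
    + (1 / 2 : ℂ) • ∑ i, (C.w (T.cartanForm i) * C.s (T.cartan i)
      - C.s (T.cartan i) * C.w (T.cartanForm i))

lemma act_rootVec (α : H.root) : C.act T.toBasis (T.rootVec α) = C.ghostRoot T α := by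
  classical
  have h1 : ∀ i, C.w (T.toBasis.coord (Sum.inl i)) * C.s ⁅T.rootVec α, T.toBasis (Sum.inl i)⁆ =
      -(T.rootVal α i • (C.w (T.cartanForm i) * C.s (T.rootVec α))) := by
    intro i
    have := T.lie_rootVec_cartan α i
    rw [RootBasis.cartan] at this
    rw [this, map_neg, map_smul, mul_neg, mul_smul_comm]
  have h2 : ∀ β, C.w (T.toBasis.coord (Sum.inr β)) * C.s ⁅T.rootVec α, T.toBasis (Sum.inr β)⁆ =
      ∑ γ, T.structConst α β γ • (C.c T (negRoot β) * C.s (T.rootVec γ))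
        - if β = negRoot α then ∑ i, T.corootCoord α i • (C.c T α * C.s (T.cartan i)) else 0 := by
    intro β
    have := T.lie_rootVec_rootVec α β
    rw [RootBasis.rootVec.eq_1 T β] at this
    rw [this, map_sub, mul_sub, map_sum, Finset.mul_sum]
    simp only [map_smul, mul_smul_comm, c, negRoot_negRoot]
    congr 1
    split_ifs with h
    · subst h
      simp only [map_sum, map_smul, Finset.mul_sum, mul_smul_comm]
    · simp
  rw [act, Fintype.sum_sum_type]
  simp only [h1, h2, Finset.sum_sub_distrib, Finset.sum_neg_distrib, Finset.sum_ite_eq',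
    Finset.mem_univ, if_true, ghostRoot]
  abel

/-- Each reordering of b_{-β} c^β produces the scalar β(H_i); these add up to 2ρ(H_i). -/
lemma act_cartan (i : Fin (finrank ℂ H)) :
    C.act T.toBasis (T.cartan i) =
      C.ghostCartan T Δ i + (∑ β ∈ posRoots Δ, T.rootVal β i) • 1 := by
  have h1 : ∀ j, C.w (T.toBasis.coord (Sum.inl j)) * C.s ⁅T.cartan i, T.toBasis (Sum.inl j)⁆ =
      0 := by
    intro j
    have : ⁅T.cartan i, T.toBasis (Sum.inl j)⁆ = 0 := T.lie_cartan ⟨T.cartan i, T.cartan_mem i⟩ j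
    rw [this, map_zero, mul_zero]
  have h2 : ∀ β, C.w (T.toBasis.coord (Sum.inr β)) * C.s ⁅T.cartan i, T.toBasis (Sum.inr β)⁆ =
      T.rootVal β i • (C.w (T.rootForm β) * C.s (T.rootVec β)) := by
    intro β
    have : ⁅T.cartan i, T.toBasis (Sum.inr β)⁆ = T.rootVal β i • T.rootVec β :=
      T.lie_rootVec ⟨T.cartan i, T.cartan_mem i⟩ β
    rw [this, map_smul, mul_smul_comm]
  have h3 : ∀ β, C.s (T.rootVec (negRoot β)) * C.w (T.rootForm (negRoot β)) =
      1 - C.w (T.rootForm (negRoot β)) * C.s (T.rootVec (negRoot β)) := by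
    classical
    intro β
    rw [s_mul_w, T.rootForm_rootVec, if_pos rfl, one_smul]
  have h4 : ∀ β, T.rootVal (negRoot β) i = -T.rootVal β i := fun β => rfl
  rw [act, Fintype.sum_sum_type]
  simp only [h1, h2, Finset.sum_const_zero, zero_add, ghostCartan, c, negRoot_negRoot, h3,
    sum_root_eq Δ, h4, smul_sub, Finset.sum_sub_distrib, neg_smul, Finset.sum_neg_distrib,
    Finset.sum_smul]
  abel

/-- The correction is the coadjoint action of τ_{-α} on its own dual form. Only Cartan forms occur
in it, by `structConst_self`. -/
lemma ghostRoot_mul_c (α : H.root) :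
    C.ghostRoot T (negRoot α) * C.c T α =
      C.c T α * C.ghostRoot T (negRoot α) - ∑ i, T.rootVal α i • C.w (T.cartanForm i) := by
  rw [← act_rootVec, c, act_mul_w, sub_eq_add_neg]
  congr 1
  have h1 : ∀ i, T.rootForm (negRoot α) ⁅T.rootVec (negRoot α), T.toBasis (Sum.inl i)⁆ =
      T.rootVal α i := by
    classical
    intro i
    have := T.lie_rootVec_cartan (negRoot α) i
    rw [RootBasis.cartan] at this
    rw [this, map_neg, map_smul, T.rootForm_rootVec, if_pos rfl, smul_eq_mul, mul_one]
    exact neg_neg _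
  have h2 : ∀ β, T.rootForm (negRoot α) ⁅T.rootVec (negRoot α), T.toBasis (Sum.inr β)⁆ = 0 :=
    fun β => T.structConst_self (negRoot α) β
  rw [C.w_coad T.toBasis, Fintype.sum_sum_type]
  simp only [h1, h2, zero_smul, Finset.sum_const_zero, add_zero]

/-- Normal ordering shifts the Chevalley–Eilenberg differential by the sum of the positive
roots. -/
lemma ghostDiff_eq : C.ghostDiff T Δ = C.ceDiff T.toBasis - C.w (T.twoRho Δ) := by
  -- Half of 2ρ comes from the Cartan terms here; the other half comes from moving c^α to the left
  -- of L_{-α}.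
  have h1 : C.ceDiff T.toBasis = (1 / 2 : ℂ) • (∑ i, C.w (T.cartanForm i) * C.ghostCartan T Δ i)
      + (1 / 2 : ℂ) • C.w (T.twoRho Δ)
      + (1 / 2 : ℂ) • (∑ α ∈ posRoots Δ, C.c T (negRoot α) * C.ghostRoot T α)
      + (1 / 2 : ℂ) • (∑ α ∈ posRoots Δ, C.c T α * C.ghostRoot T (negRoot α)) := by
    have ha : ∀ α, C.w (T.toBasis.coord (Sum.inr α)) * C.act T.toBasis (T.toBasis (Sum.inr α)) =
        C.c T (negRoot α) * C.ghostRoot T α := by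
      intro α
      rw [c, negRoot_negRoot, ← act_rootVec]
      rfl
    have hi : ∀ i, C.w (T.toBasis.coord (Sum.inl i)) * C.act T.toBasis (T.toBasis (Sum.inl i)) =
        C.w (T.cartanForm i) * C.ghostCartan T Δ i
          + ∑ β ∈ posRoots Δ, T.rootVal β i • C.w (T.cartanForm i) := by
      intro i
      have := C.act_cartan T Δ i
      rw [RootBasis.cartan] at this
      rw [this, mul_add, mul_smul_comm, mul_one, Finset.sum_smul]
    have hr : C.w (T.twoRho Δ) =
        ∑ i, ∑ β ∈ posRoots Δ, T.rootVal β i • C.w (T.cartanForm i) := by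
      rw [Finset.sum_comm]
      simp only [RootBasis.twoRho, map_sum, map_smul]
    rw [ceDiff, Fintype.sum_sum_type]
    simp only [ha, hi, sum_root_eq Δ, negRoot_negRoot, Finset.sum_add_distrib, ← hr, smul_add]
    abel
  have h2 : C.w (T.twoRho Δ) = ∑ β ∈ posRoots Δ, ∑ i, T.rootVal β i • C.w (T.cartanForm i) := by
    simp only [RootBasis.twoRho, map_sum, map_smul]
  rw [h1, ghostDiff]
  simp only [ghostRoot_mul_c, Finset.sum_sub_distrib, ← h2]
  module

/-- The operator `∑ c^i b_i` counting the ghosts of the Cartan subalgebra. -/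
def cartanNumber : A := ∑ i, C.w (T.cartanForm i) * C.s (T.cartan i)

/-- Identifies the sl₂ weight operator: symmetric ordering of the l Cartan pairs in gh contributes K
- l/2, which has to be removed. -/
lemma sum_pos_number_eq :
    ∑ α ∈ posRoots Δ, (C.w (T.rootForm α) * C.s (T.rootVec α)
      + C.w (T.rootForm (negRoot α)) * C.s (T.rootVec (negRoot α)) - 1) =
      C.ghostNumber T Δ + (((finrank ℂ H : ℝ) / 2 : ℝ) : ℂ) • 1 - C.cartanNumber T := by
  classical
  have h3 : ∀ β, C.s (T.rootVec (negRoot β)) * C.w (T.rootForm (negRoot β)) =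
      1 - C.w (T.rootForm (negRoot β)) * C.s (T.rootVec (negRoot β)) := by
    intro β
    rw [s_mul_w, T.rootForm_rootVec, if_pos rfl, one_smul]
  have h4 : ∀ i, C.s (T.cartan i) * C.w (T.cartanForm i) =
      1 - C.w (T.cartanForm i) * C.s (T.cartan i) := by
    intro i
    rw [s_mul_w, T.cartanForm_cartan, if_pos rfl, one_smul]
  have h5 : ∑ _i : Fin (finrank ℂ H), (1 : A) = (finrank ℂ H : ℂ) • 1 := by
    simp [Algebra.smul_def]
  simp only [ghostNumber, cartanNumber, c, negRoot_negRoot, h3, h4, Finset.sum_sub_distrib,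
    Finset.sum_add_distrib, h5]
  push_cast
  module

/-- Ghost number is form degree up to a constant, so its commutators are those of the degree
operator. -/
lemma ghostNumber_eq : C.ghostNumber T Δ = C.number T.toBasis
    - ((posRoots Δ).card + (finrank ℂ H : ℂ) / 2) • 1 := by
  have h := C.sum_pos_number_eq T Δ
  have h1 : C.number T.toBasis = C.cartanNumber T
      + ∑ α ∈ posRoots Δ, C.w (T.rootForm α) * C.s (T.rootVec α)
      + ∑ α ∈ posRoots Δ, C.w (T.rootForm (negRoot α)) * C.s (T.rootVec (negRoot α)) := by
    rw [number, Fintype.sum_sum_type, add_assoc, ← sum_root_eq Δ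
      (fun α => C.w (T.rootForm α) * C.s (T.rootVec α))]
    rfl
  have h5 : ∑ _i ∈ posRoots Δ, (1 : A) = ((posRoots Δ).card : ℂ) • 1 := by
    simp [Algebra.smul_def]
  simp only [Finset.sum_sub_distrib, Finset.sum_add_distrib, h5] at h
  rw [← sub_eq_zero] at h ⊢
  rw [h1, ← neg_eq_zero, ← h]
  push_cast
  module

/-- `dλ` is a sum of hyperbolic planes over the positive roots. -/
lemma wd_eq_raising (lam : Dual ℂ 𝔤) (hl : ∀ α, lam (T.rootVec α) = 0) :
    C.wd T.toBasis lam = C.raising (posRoots Δ) T.rootForm (fun α => T.rootForm (negRoot α))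
      (fun α => lam ((coroot α.1 : H) : 𝔤)) := by
  classical
  have h1 : ∀ i y, lam ⁅T.toBasis (Sum.inl i), y⁆ = 0 := by
    intro i y
    have := T.lie_eq ⟨T.cartan i, T.cartan_mem i⟩ y
    have h : lam ⁅T.cartan i, y⁆ = 0 := by
      rw [this]
      simp only [map_sum, map_smul, hl, smul_zero, Finset.sum_const_zero]
    exact h
  have h2 : ∀ α i, lam ⁅T.toBasis (Sum.inr α), T.toBasis (Sum.inl i)⁆ = 0 := by
    intro α i
    rw [← lie_skew, map_neg, h1, neg_zero]
  have h3 : ∀ α β, lam ⁅T.toBasis (Sum.inr α), T.toBasis (Sum.inr β)⁆ =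
      if β = negRoot α then -lam ((coroot α.1 : H) : 𝔤) else 0 := by
    intro α β
    have h : lam ⁅T.rootVec α, T.rootVec β⁆ =
        if β = negRoot α then -lam ((coroot α.1 : H) : 𝔤) else 0 := by
      rw [T.lie_rootVec_rootVec, ← T.coroot_eq_sum, map_sub, map_sum]
      simp only [map_smul, hl, smul_zero, Finset.sum_const_zero, zero_sub]
      split_ifs <;> simp
    exact h
  -- Exchanging α and -α changes the sign of both the coroot and the wedge product, so the two
  -- contributions agree and absorb the factor ½.
  have h4 : ∀ α : H.root, lam ((coroot (negRoot α).1 : H) : 𝔤) = -lam ((coroot α.1 : H) : 𝔤) := by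
    intro α
    rw [coroot_negRoot, ← map_neg]
    rfl
  rw [wd]
  simp only [Fintype.sum_sum_type, h1, h2, h3, zero_smul, Finset.sum_const_zero, zero_add,
    ite_smul, Finset.sum_ite_eq', Finset.mem_univ, if_true]
  rw [sum_root_eq Δ]
  simp only [h4, negRoot_negRoot, raising]
  have h5 : ∀ α, C.w (T.toBasis.coord (Sum.inr (negRoot α))) * C.w (T.toBasis.coord (Sum.inr α)) =
      -(C.w (T.rootForm α) * C.w (T.rootForm (negRoot α))) := fun α => C.w_mul_comm _ _
  simp only [h5, neg_smul, smul_neg, neg_neg, Finset.sum_neg_distrib]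
  module

end CliffordPair

/-! ### Surjectivity of dλ and exactness in high ghost number. -/

namespace CliffordPair

variable {𝔤 : Type*} [LieRing 𝔤] [LieAlgebra ℂ 𝔤] [FiniteDimensional ℂ 𝔤] [IsKilling ℂ 𝔤]
  {H : LieSubalgebra ℂ 𝔤} [H.IsCartanSubalgebra] {A B : Type*} [Ring A] [Algebra ℂ A]
  [Ring B] [Algebra ℂ B] (C : CliffordPair 𝔤 A) (T : RootBasis H) (Δ : (rootSystem H).Base)

lemma isUnit_cartanNumber_sub (s : ℝ) (hs : (finrank ℂ H : ℝ) < s) :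
    IsUnit (C.cartanNumber T - (s : ℂ) • 1) := by
  classical
  refine isUnit_sum_idempotents_sub Finset.univ
    (fun i => C.w (T.cartanForm i) * C.s (T.cartan i)) (fun i => ?_) (fun i j => ?_) s (by simpa)
  · rw [← mul_assoc, number_mul_w, T.cartanForm_cartan, if_pos rfl, one_smul, add_mul,
      mul_assoc, mul_assoc, C.s_mul_self, mul_zero, mul_zero, zero_add]
  · rcases eq_or_ne i j with rfl | hij
    · exact Commute.refl _
    · rw [Commute, SemiconjBy, ← mul_assoc, number_mul_w, T.cartanForm_cartan, if_neg hij.symm,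
        zero_smul, add_zero, mul_assoc, number_mul_s, T.cartanForm_cartan, if_neg hij, zero_smul,
        sub_zero, mul_assoc]

lemma cartanNumber_commute_w (α : H.root) :
    Commute (C.cartanNumber T) (C.w (T.rootForm α)) := by
  refine Commute.sum_left _ _ _ fun i _ => ?_
  rw [Commute, SemiconjBy, number_mul_w, T.rootForm_cartan, zero_smul, add_zero]

lemma cartanNumber_commute_number : Commute (C.cartanNumber T) (C.number T.toBasis) := by
  refine Commute.sum_left _ _ _ fun i _ => Commute.symm ?_
  rw [Commute, SemiconjBy, ← mul_assoc, number_mul_w', add_mul, mul_assoc, number_mul_s', mul_sub,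
    sub_add_cancel, mul_assoc]

lemma map_ghostNumber (φ : A →ₐ[ℂ] B) :
    (C.map φ).ghostNumber T Δ = φ (C.ghostNumber T Δ) := by
  simp [ghostNumber, c]

lemma number_mul_wd (lam : Dual ℂ 𝔤) :
    C.number T.toBasis * C.wd T.toBasis lam =
      C.wd T.toBasis lam * C.number T.toBasis + (2 : ℂ) • C.wd T.toBasis lam := by
  have h : ∀ a b, C.number T.toBasis * (C.w (T.toBasis.coord a) * C.w (T.toBasis.coord b)) =
      C.w (T.toBasis.coord a) * C.w (T.toBasis.coord b) * C.number T.toBasis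
        + (2 : ℂ) • (C.w (T.toBasis.coord a) * C.w (T.toBasis.coord b)) := by
    intro a b
    rw [← mul_assoc, number_mul_w', add_mul, mul_assoc, number_mul_w', mul_add, mul_assoc,
      two_smul, add_assoc]
  simp only [wd, mul_neg, neg_mul, mul_smul_comm, smul_mul_assoc, Finset.mul_sum, Finset.sum_mul,
    h, smul_add, Finset.sum_add_distrib, neg_add, smul_neg]
  congr 2
  simp only [Finset.smul_sum, smul_smul]
  refine Finset.sum_congr rfl fun a _ => Finset.sum_congr rfl fun b _ => ?_
  congr 1
  ring

lemma number_mul_lowering {κ : Type*} (S : Finset κ) (x y : κ → 𝔤) (m : κ → ℂ) :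
    C.number T.toBasis * C.lowering S x y m =
      C.lowering S x y m * C.number T.toBasis - (2 : ℂ) • C.lowering S x y m := by
  have h : ∀ k, C.number T.toBasis * (C.s (y k) * C.s (x k)) =
      C.s (y k) * C.s (x k) * C.number T.toBasis - (2 : ℂ) • (C.s (y k) * C.s (x k)) := by
    intro k
    rw [← mul_assoc, number_mul_s', sub_mul, mul_assoc, number_mul_s', mul_sub, mul_assoc,
      two_smul]
    abel
  simp only [lowering, mul_smul_comm, smul_mul_assoc, Finset.mul_sum, Finset.sum_mul, h, smul_sub,
    Finset.sum_sub_distrib, Finset.smul_sum]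
  congr 1
  refine Finset.sum_congr rfl fun k _ => smul_comm _ _ _

variable {N : Type*} [AddCommGroup N] [Module ℂ N] (C : CliffordPair 𝔤 (End ℂ N))

/-- Exterior multiplication by `dλ` is onto in high ghost number if `λ` is regular. -/
lemma exists_wd_eq (lam : Dual ℂ 𝔤) (hl : ∀ α, lam (T.rootVec α) = 0)
    (hreg : ∀ α ∈ posRoots Δ, lam ((coroot α.1 : H) : 𝔤) ≠ 0) (r : ℝ)
    (hr : (finrank ℂ H : ℝ) / 2 < r) (u : N) (hu : C.ghostNumber T Δ u = (r : ℂ) • u) :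
    ∃ v, C.ghostNumber T Δ v = ((r - 2 : ℝ) : ℂ) • v ∧ C.wd T.toBasis lam v = u := by
  classical
  have hE := C.wd_eq_raising T Δ lam hl
  set m : H.root → ℂ := fun α => lam ((coroot α.1 : H) : 𝔤) with hm
  have hEF := C.raising_lowering (posRoots Δ) T.rootForm (fun α => T.rootForm (negRoot α))
    T.rootVec (fun α => T.rootVec (negRoot α)) m hreg
    (fun j k h => by rw [T.rootForm_rootVec, if_neg h])
    (fun j k h => by
      rw [T.rootForm_rootVec, if_neg fun h' => h (by
        rw [← negRoot_negRoot j, h', negRoot_negRoot])])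
    (fun k => by rw [T.rootForm_rootVec, if_pos rfl])
    (fun k => by rw [T.rootForm_rootVec, if_pos rfl])
    (fun j hj k hk => by
      rw [T.rootForm_rootVec, if_neg]
      rintro rfl
      exact negRoot_mem_posRoots.mp hj hk)
    (fun j hj k hk => by
      rw [T.rootForm_rootVec, if_neg]
      rintro rfl
      exact negRoot_mem_posRoots.mp hk hj)
  rw [sum_pos_number_eq, ← hE] at hEF
  have hK : Commute (C.cartanNumber T) (C.wd T.toBasis lam) := by
    rw [hE]
    exact Commute.sum_right _ _ _ fun α _ =>
      ((C.cartanNumber_commute_w T _).mul_right (C.cartanNumber_commute_w T _)).smul_right _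
  have hKG : Commute (C.cartanNumber T) (C.ghostNumber T Δ) := by
    rw [ghostNumber_eq]
    exact (C.cartanNumber_commute_number T).sub_right ((Commute.one_right _).smul_right _)
  have hGE : C.ghostNumber T Δ * C.wd T.toBasis lam =
      C.wd T.toBasis lam * C.ghostNumber T Δ + (2 : ℂ) • C.wd T.toBasis lam := by
    rw [ghostNumber_eq, sub_mul, mul_sub, number_mul_wd, smul_mul_assoc, mul_smul_comm, one_mul,
      mul_one]
    abel
  have hGF : C.ghostNumber T Δ *
        C.lowering (posRoots Δ) T.rootVec (fun α => T.rootVec (negRoot α)) m =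
      C.lowering (posRoots Δ) T.rootVec (fun α => T.rootVec (negRoot α)) m * C.ghostNumber T Δ -
        (2 : ℂ) • C.lowering (posRoots Δ) T.rootVec (fun α => T.rootVec (negRoot α)) m := by
    rw [ghostNumber_eq, sub_mul, mul_sub, number_mul_lowering, smul_mul_assoc, mul_smul_comm,
      one_mul, mul_one]
    abel
  -- With c = l/2 and K bounded by l, the requirement l < r + c is exactly r > l/2.
  refine exists_raising_eq _ _ _ (C.cartanNumber T) ((finrank ℂ H : ℝ) / 2) (finrank ℂ H) hEF
    hGE hGF hK hKG ?_ (fun s hs => C.isUnit_cartanNumber_sub T s hs) r (by linarith) u hu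
  rw [hE]
  exact C.isNilpotent_raising _ _ _ _

/-- In high ghost number every cocycle of the shifted differential is the differential of an
anomalous cochain. -/
theorem exists_totalDiff_eq (hd : C.ceDiff T.toBasis * C.ceDiff T.toBasis = 0)
    (R : 𝔤 →ₗ[ℂ] End ℂ N) (hR : ∀ x y, R ⁅x, y⁆ = R x * R y - R y * R x)
    (hw : ∀ x θ, R x * C.w θ = C.w θ * R x) (hs : ∀ x y, R x * C.s y = C.s y * R x)
    (χ : Dual ℂ 𝔤) (hχ : IsRegularDominant Δ χ) (D : End ℂ N)
    (hD : D = ∑ a, C.w (T.toBasis.coord a) * R (T.toBasis a) + C.ceDiff T.toBasis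
      - C.w (χ + T.twoRho Δ))
    (r : ℝ) (hr : (finrank ℂ H : ℝ) / 2 < r) (u : N)
    (hu : C.ghostNumber T Δ u = (r : ℂ) • u) (hDu : D u = 0) :
    ∃ v, C.ghostNumber T Δ v = ((r - 1 : ℝ) : ℂ) • v ∧ D (D v) = 0 ∧ D v = u := by
  have hDD : D * D = -C.wd T.toBasis (χ + T.twoRho Δ) := by
    rw [hD]
    exact C.totalDiff_mul_self T.toBasis hd R hR hw hs _
  have hl : ∀ α, (χ + T.twoRho Δ) (T.rootVec α) = 0 := fun α => by
    rw [LinearMap.add_apply, T.twoRho_rootVec, add_zero]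
    exact hχ.1 α _ (T.root_mem α)
  obtain ⟨w, hGw, hw'⟩ := C.exists_wd_eq T Δ _ hl
    (fun α hα => T.add_twoRho_coroot_ne_zero Δ χ hχ hα) r hr u hu
  have hRnum : ∀ x, Commute (R x) (C.number T.toBasis) := fun x =>
    Commute.sum_right _ _ _ fun a _ => Commute.mul_right (hw _ _) (hs _ _)
  have hnum : C.number T.toBasis * D = D * C.number T.toBasis + D := by
    have hX : C.number T.toBasis * ∑ a, C.w (T.toBasis.coord a) * R (T.toBasis a) =
        (∑ a, C.w (T.toBasis.coord a) * R (T.toBasis a)) * C.number T.toBasis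
          + ∑ a, C.w (T.toBasis.coord a) * R (T.toBasis a) := by
      simp only [Finset.mul_sum, Finset.sum_mul, ← Finset.sum_add_distrib]
      refine Finset.sum_congr rfl fun a _ => ?_
      rw [← mul_assoc, number_mul_w', add_mul, mul_assoc, ← (hRnum _).eq, mul_assoc]
    rw [hD]
    simp only [mul_add, mul_sub, add_mul, sub_mul, hX, number_mul_ceDiff, number_mul_w']
    abel
  have hG : C.ghostNumber T Δ * D = D * C.ghostNumber T Δ + D := by
    rw [ghostNumber_eq, sub_mul, mul_sub, hnum, smul_mul_assoc, mul_smul_comm, one_mul, mul_one]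
    abel
  have hDDw : D (D w) = -u := by
    rw [← Module.End.mul_apply, hDD, LinearMap.neg_apply, hw']
  -- The sign compensates for D² = -dλ; the second condition reduces to Du = 0.
  refine ⟨-D w, ?_, ?_, ?_⟩
  · have := LinearMap.congr_fun hG w
    simp only [Module.End.mul_apply, LinearMap.add_apply, hGw, map_smul] at this
    rw [map_neg, this]
    push_cast
    module
  · rw [map_neg, hDDw, neg_neg, hDu]
  · rw [map_neg, hDDw, neg_neg]

end CliffordPair

/-! ### The exterior algebra as a faithful Clifford module. -/

section Ghosts

variable {𝔤 : Type*} [LieRing 𝔤] [LieAlgebra ℂ 𝔤]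

/-- Exterior multiplications and substitutions on `⋀ 𝔤^*`. -/
def ghostPair (𝔤 : Type*) [LieRing 𝔤] [LieAlgebra ℂ 𝔤] : CliffordPair 𝔤 (End ℂ (Ghost 𝔤)) where
  w := (LinearMap.mul ℂ (Ghost 𝔤) ∘ₗ ExteriorAlgebra.ι ℂ : Dual ℂ 𝔤 →ₗ[ℂ] End ℂ (Ghost 𝔤))
  s := CliffordAlgebra.contractLeft ∘ₗ Dual.eval ℂ 𝔤
  w_mul_self θ := by
    refine LinearMap.ext fun u => ?_
    change ExteriorAlgebra.ι ℂ θ * (ExteriorAlgebra.ι ℂ θ * u) = 0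
    rw [← mul_assoc, ExteriorAlgebra.ι_sq_zero, zero_mul]
  s_mul_self x := LinearMap.ext fun _ => CliffordAlgebra.contractLeft_contractLeft ..
  s_mul_w x θ := LinearMap.ext fun _ => CliffordAlgebra.contractLeft_ι_mul ..

/-- Substitutions kill 1, and an operator commuting with all left multiplications is determined by
its value at 1. -/
lemma ghostPair_isFaithful : (ghostPair 𝔤).IsFaithful := by
  intro a ha hcomm
  have h1 : a 1 = 0 := by
    clear hcomm
    induction ha using Submodule.span_induction with
    | mem a h =>
      obtain ⟨x, rfl⟩ := h
      exact CliffordAlgebra.contractLeft_one ..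
    | zero => rfl
    | add a b _ _ ha hb => exact (congrArg₂ (· + ·) (ha) (hb)).trans (add_zero 0)
    | smul c a _ ha => exact (congrArg c (ha)).trans (map_zero c)
  have key : ∀ v u : Ghost 𝔤, a (v * u) = v * a u := by
    intro v
    induction v using ExteriorAlgebra.induction with
    | algebraMap r => intro u; simp [← Algebra.smul_def]
    | ι θ => intro u; exact LinearMap.congr_fun (hcomm θ) u
    | mul v v' hv hv' => intro u; rw [mul_assoc, hv, hv', mul_assoc]
    | add v v' hv hv' => intro u; rw [add_mul, map_add, hv, hv', add_mul]
  refine LinearMap.ext fun u => ?_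
  have := key u 1
  rwa [mul_one, h1, mul_zero] at this

end Ghosts

/-! ### Coefficients in V and the vanishing theorem. -/

section Main

variable {M : Type*} [AddCommGroup M] [Module ℂ M] (V : Type*) [AddCommGroup V] [Module ℂ V]

section Tensor

variable {𝔤 : Type*} [LieRing 𝔤] [LieAlgebra ℂ 𝔤] (C : CliffordPair 𝔤 (End ℂ M))

/-- The ghost algebra acting on the first factor of `M ⊗ V`. -/
def CliffordPair.tensor : CliffordPair 𝔤 (End ℂ (M ⊗[ℂ] V)) :=
  C.map (End.rTensorAlgHom ℂ M V)

lemma CliffordPair.tensor_w_tmul (θ : Dual ℂ 𝔤) (u : M) (v : V) :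
    (C.tensor V).w θ (u ⊗ₜ[ℂ] v) = C.w θ u ⊗ₜ v := rfl

lemma CliffordPair.tensor_ceDiff_tmul {ι : Type*} [Fintype ι] (e : Basis ι ℂ 𝔤) (u : M) (v : V) :
    (C.tensor V).ceDiff e (u ⊗ₜ[ℂ] v) = C.ceDiff e u ⊗ₜ v := by
  rw [tensor, map_ceDiff]
  rfl

variable [LieRingModule 𝔤 V] [LieModule ℂ 𝔤 V]

/-- The action of `𝔤` on the second factor of `M ⊗ V`. -/
def rightAct (M : Type*) [AddCommGroup M] [Module ℂ M] : 𝔤 →ₗ[ℂ] End ℂ (M ⊗[ℂ] V) :=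
  LinearMap.lTensorHom M ∘ₗ (LieModule.toEnd ℂ 𝔤 V : 𝔤 →ₗ[ℂ] End ℂ V)

lemma rightAct_tmul (x : 𝔤) (u : M) (v : V) : rightAct V M x (u ⊗ₜ[ℂ] v) = u ⊗ₜ ⁅x, v⁆ := rfl

end Tensor

variable {𝔤 : Type*} [LieRing 𝔤] [LieAlgebra ℂ 𝔤] [FiniteDimensional ℂ 𝔤] [IsKilling ℂ 𝔤]
  {H : LieSubalgebra ℂ 𝔤} [H.IsCartanSubalgebra] (T : RootBasis H) (Δ : (rootSystem H).Base)
  (C : CliffordPair 𝔤 (End ℂ M)) [LieRingModule 𝔤 V] [LieModule ℂ 𝔤 V]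

/-- The shifts in the constraints assemble to -χ because χ is expanded in the dual basis; normal
ordering supplies the remaining -2ρ. -/
lemma CliffordPair.totalDiff_eq (χ : Dual ℂ 𝔤) :
    (∑ α : H.root, TensorProduct.map (C.c T (negRoot α))
        (RootBasis.constraint χ V (T.rootVec α)))
      + (∑ i, TensorProduct.map (C.w (T.cartanForm i)) (RootBasis.constraint χ V (T.cartan i)))
      + TensorProduct.map (C.ghostDiff T Δ) LinearMap.id =
    ∑ a, (C.tensor V).w (T.toBasis.coord a) * rightAct V M (T.toBasis a)
      + (C.tensor V).ceDiff T.toBasis - (C.tensor V).w (χ + T.twoRho Δ) := by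
  refine TensorProduct.ext' fun u v => ?_
  have hχ : C.w χ = ∑ i, χ (T.cartan i) • C.w (T.cartanForm i)
      + ∑ α, χ (T.rootVec α) • C.w (T.rootForm α) := by
    conv_lhs => rw [← sum_apply_smul_coord T.toBasis χ, Fintype.sum_sum_type, map_add, map_sum,
      map_sum]
    simp only [map_smul]
    rfl
  have hr : ∀ α, T.toBasis (Sum.inr α) = T.rootVec α := fun _ => rfl
  have hc : ∀ i, T.toBasis (Sum.inl i) = T.cartan i := fun _ => rfl
  simp only [LinearMap.add_apply, LinearMap.sub_apply, LinearMap.sum_apply, TensorProduct.map_tmul,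
    C.ghostDiff_eq, CliffordPair.c, negRoot_negRoot, map_add, hχ, RootBasis.constraint,
    Fintype.sum_sum_type, Module.End.mul_apply, rightAct_tmul, tensor_w_tmul, tensor_ceDiff_tmul,
    LinearMap.id_apply, LinearMap.smul_apply, Module.End.one_apply, LieModule.toEnd_apply_apply,
    TensorProduct.tmul_sub, TensorProduct.sub_tmul, TensorProduct.add_tmul,
    TensorProduct.sum_tmul, TensorProduct.tmul_smul, TensorProduct.smul_tmul',
    Finset.sum_sub_distrib, hr, hc]
  abel

theorem CliffordPair.exists_tensor_totalDiff_eq (hC : C.IsFaithful)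
    (χ : Dual ℂ 𝔤) (hχ : IsRegularDominant Δ χ) (D : End ℂ (M ⊗[ℂ] V))
    (hD : D = (∑ α : H.root, TensorProduct.map (C.c T (negRoot α))
        (RootBasis.constraint χ V (T.rootVec α)))
      + (∑ i, TensorProduct.map (C.w (T.cartanForm i)) (RootBasis.constraint χ V (T.cartan i)))
      + TensorProduct.map (C.ghostDiff T Δ) LinearMap.id)
    (r : ℝ) (hr : (finrank ℂ H : ℝ) / 2 < r) (u : M ⊗[ℂ] V)
    (hu : TensorProduct.map (C.ghostNumber T Δ) LinearMap.id u = (r : ℂ) • u) (hDu : D u = 0) :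
    ∃ v, TensorProduct.map (C.ghostNumber T Δ) LinearMap.id v = ((r - 1 : ℝ) : ℂ) • v ∧
      D (D v) = 0 ∧ D v = u := by
  rw [C.totalDiff_eq V T Δ χ] at hD
  have hG : (C.tensor V).ghostNumber T Δ = TensorProduct.map (C.ghostNumber T Δ) LinearMap.id := by
    rw [tensor, map_ghostNumber]
    rfl
  rw [← hG] at hu ⊢
  refine (C.tensor V).exists_totalDiff_eq T Δ ?_ (rightAct V M) ?_ ?_ ?_ χ hχ D hD r hr u hu hDu
  · rw [tensor, map_ceDiff, ← map_mul, C.ceDiff_mul_self T.toBasis hC, map_zero]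
  · intro x y
    refine TensorProduct.ext' fun u v => ?_
    simp only [LinearMap.sub_apply, Module.End.mul_apply, rightAct_tmul, lie_lie,
      TensorProduct.tmul_sub]
  · intro x θ
    exact TensorProduct.ext' fun u v => rfl
  · intro x y
    exact TensorProduct.ext' fun u v => rfl

end Main

end

end AnomalousBRST

theorem corollary2p2
    {𝔤 : Type*} [LieRing 𝔤] [LieAlgebra ℂ 𝔤] [FiniteDimensional ℂ 𝔤] [LieAlgebra.IsKilling ℂ 𝔤]
    {H : LieSubalgebra ℂ 𝔤} [H.IsCartanSubalgebra]
    (Δ : (LieAlgebra.IsKilling.rootSystem H).Base)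
    (T : AnomalousBRST.RootBasis H)
    (χ : Module.Dual ℂ 𝔤) (hχ : AnomalousBRST.IsRegularDominant Δ χ)
    (V : Type*) [AddCommGroup V] [Module ℂ V] [LieRingModule 𝔤 V] [LieModule ℂ 𝔤 V]
    (r : ℝ) (hr : (Module.finrank ℂ H : ℝ) / 2 < r) :
    Subsingleton (T.cohomology Δ χ V r) := by
  refine Submodule.Quotient.subsingleton_iff.mpr (Submodule.eq_top_iff'.mpr ?_)
  rintro ⟨u, ⟨-, hu⟩, hDu⟩
  -- The concrete ghost operators are by definition the abstract ones at `ghostPair 𝔤`, hence `rfl`.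
  obtain ⟨v, hGv, hDDv, hDv⟩ :=
    (AnomalousBRST.ghostPair 𝔤).exists_tensor_totalDiff_eq V T Δ AnomalousBRST.ghostPair_isFaithful
      χ hχ (T.totalDiff Δ χ V) rfl r hr u (Module.End.mem_eigenspace_iff.mp hu) hDu
  exact ⟨v, ⟨hDDv, Module.End.mem_eigenspace_iff.mpr hGv⟩, hDv⟩
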